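/- **Setting.** Let $\mathcal H=(C,F,D,G)$ be a hybrid system on $\mathbb R^n$, $$x\in C,\ \dot x\in F(x);\qquad x\in D,\ x^+\in G(x),$$ satisfying the hybrid basic conditions: $C,D\subset\mathbb R^n$ are closed; $F:\mathbb R^n\rightrightarrows\mathbb R^n$ is outer semicontinuous and locally bounded relative to $C$, with $F(x)$ nonempty and convex for every $x\in C$; $G:\mathbb R^n\rightrightarrows\mathbb R^n$ is outer semicontinuous and locally bounded relative to $D$, with $G(x)$ nonempty for every $x\in D$. Solutions $\varphi$ (not necessarily maximal) are hybrid arcs: functions on a nonempty hybrid time domain $\operatorname{dom}\varphi\subset\mathbb R_{\ge0}\times\mathbb N$, locally absolutely continuous in $t$ on each $I^j=\{t:(t,j)\in\operatorname{dom}\varphi\}$, with $\varphi(0,0)\in \overline C\cup D$, $\varphi(t,j)\in C$ for all $t\in\operatorname{int} I^j$, $\dot\varphi(t,j)\in F(\varphi(t,j))$ for almost all $t\in I^j$, and $\varphi(t,j)\in D$, $\varphi(t,j+1)\in G(\varphi(t,j))$ whenever $(t,j),(t,j+1)\in\operatorname{dom}\varphi$. A solution is complete if $\operatorname{dom}\varphi$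 is unbounded. **Definitions.** Let $\mathbb B$ be the open unit ball, $|z|_X=\inf_{w\in X}|z-w|$, and let $X,Y\subset\mathbb R^n$. - $X$ is *strongly forward invariant* if all solutions starting in $X$ remain in $X$. - $X$ is *stable relative to $Y$* if for all $\epsilon,\Delta>0$ there is $\delta>0$ such that every solution with $\varphi(0,0)\in Y\cap(X+\delta\mathbb B)\cap\Delta\mathbb B$ satisfies $\varphi(t,j)\in X+\epsilon\mathbb B$ for all $(t,j)\in\operatorname{dom}\varphi$. - $X$ is *attractive relative to $Y$* if for some $\delta>0$, and *globally attractive relative to $Y$* if for all $\delta>0$, every solution with $\varphi(0,0)\in Y\cap (X+\delta\mathbb B)$ satisfies $\lim_{t+j\to+\infty}|\varphi(t,j)|_X=0$ (no requirement when $\varphi$ is not complete). - The *basin of attraction* $B_X$ is the set of all points from which all solutions converge to $X$, that is, $\lim_{t+j\to+\infty}|\varphi(t,j)|_X=0$ for every solution, where a solution that is not complete is required to be bounded (no finite escape). - A compact $X$ is *UAS relative to $Y$* if it is stable and attractive relative to $Y$ and, for each compact $K\subset B_X\cap Y$ and each $\epsilon>0$, there is $T$ such that every solution with $\varphi(0,0)\in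 K$ satisfies $|\varphi(t,j)|_X\le\epsilon$ for all $(t,j)\in\operatorname{dom}\varphi$ with $t+j\ge T$. It is *UGAS relative to $Y$* if moreover $B_X\cap Y=Y$. - Solutions are *UGB relative to $Y$* if for each compact $K\subset Y$ there is $\Delta>0$ such that $\varphi(0,0)\in K$ implies $|\varphi(t,j)|<\Delta$ for all $(t,j)\in\operatorname{dom}\varphi$. **Lemma.** Assume that the closed set $\mathcal M_e\subset\mathbb R^n$ is strongly forward invariant; that the closed set $\mathcal M_i\subset\mathcal M_e$ is stable and globally attractive relative to $\mathcal M_e$; and that the nonempty compact set $\mathcal M_\circ\subset\mathcal M_i$ is stable and globally attractive relative to $\mathcal M_i$. Then $\mathcal M_\circ$ is UAS relative to $\mathcal M_e$, and $B_{\mathcal M_\circ}\cap\mathcal M_e$ is the largest subset of $\mathcal M_e$ from which all solutions are bounded. In particular, if solutions are UGB relative to $\mathcal M_e$, then $\mathcal M_\circ$ is UGAS relative to $\mathcal M_e$. Finally, if in the assumptions global attractivity is replaced by attractivity (both for $\mathcal M_i$ relative to $\mathcal M_e$ and for $\mathcal M_\circ$ relative to $\mathcal M_i$), then $\mathcal M_\circ$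 is still UAS relative to $\mathcal M_e$. -/

import Mathlib

open Filter Topology

/-- A compact hybrid time domain: `⋃_{j < J} [t j, t (j+1)] × {j}` with
`0 = t 0 ≤ t 1 ≤ ⋯ ≤ t J` (the values of `t` beyond `J` play no role). -/
def IsCompactHybridTimeDomain (E : Set (ℝ × ℕ)) : Prop :=
  ∃ (J : ℕ) (t : ℕ → ℝ), t 0 = 0 ∧ Monotone t ∧
    E = {p | p.2 < J ∧ t p.2 ≤ p.1 ∧ p.1 ≤ t (p.2 + 1)}

/-- A hybrid time domain: a subset of `ℝ≥0 × ℕ` all of whose truncations at its own points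
are compact hybrid time domains. -/
def IsHybridTimeDomain (E : Set (ℝ × ℕ)) : Prop :=
  (∀ p ∈ E, 0 ≤ p.1) ∧
    ∀ p ∈ E, IsCompactHybridTimeDomain (E ∩ {q | 0 ≤ q.1 ∧ q.1 ≤ p.1 ∧ q.2 ≤ p.2})

/-- A hybrid arc: a function on a nonempty hybrid time domain which is, for each `j`, locally
absolutely continuous in `t`. Only the values of `toFun` on `dom` are meaningful. -/
structure HybridArc (n : ℕ) where
  dom : Set (ℝ × ℕ)
  toFun : ℝ × ℕ → EuclideanSpace ℝ (Fin n)
  dom_nonempty : dom.Nonempty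
  isHybridTimeDomain : IsHybridTimeDomain dom
  locallyAbsolutelyContinuous : ∀ (j : ℕ) (a b : ℝ), (a, j) ∈ dom → (b, j) ∈ dom →
    AbsolutelyContinuousOnInterval (fun t => toFun (t, j)) a b

namespace HybridArc

variable {n : ℕ}

/-- The initial value `φ(0,0)`. -/
def init (φ : HybridArc n) : EuclideanSpace ℝ (Fin n) := φ.toFun (0, 0)

/-- The interval `I^j = {t | (t, j) ∈ dom φ}`. -/
def interval (φ : HybridArc n) (j : ℕ) : Set ℝ := {t | (t, j) ∈ φ.dom}

/-- The arc is complete: its time domain is unbounded. -/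
def IsComplete (φ : HybridArc n) : Prop :=
  ∀ T : ℝ, ∃ p ∈ φ.dom, T ≤ p.1 + p.2

/-- The arc has bounded range. -/
def IsBounded (φ : HybridArc n) : Prop := Bornology.IsBounded (φ.toFun '' φ.dom)

/-- `|φ(t,j)|_X → 0` as `t + j → +∞` with `(t,j) ∈ dom φ`. No condition is imposed if `dom φ`
is bounded. -/
def ConvergesTo (φ : HybridArc n) (X : Set (EuclideanSpace ℝ (Fin n))) : Prop :=
  Tendsto (fun p => Metric.infDist (φ.toFun p) X)
    (comap (fun p : ℝ × ℕ => p.1 + (p.2 : ℝ)) atTop ⊓ 𝓟 φ.dom) (𝓝 0)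

end HybridArc

/-- Outer semicontinuity of a set-valued map relative to a set `S`. -/
def OuterSemicontinuousRel {n : ℕ}
    (M : EuclideanSpace ℝ (Fin n) → Set (EuclideanSpace ℝ (Fin n)))
    (S : Set (EuclideanSpace ℝ (Fin n))) : Prop :=
  ∀ x ∈ S, ∀ (u v : ℕ → EuclideanSpace ℝ (Fin n)) (y : EuclideanSpace ℝ (Fin n)),
    (∀ k, u k ∈ S) → (∀ k, v k ∈ M (u k)) →
    Tendsto u atTop (𝓝 x) → Tendsto v atTop (𝓝 y) → y ∈ M x

/-- Local boundedness of a set-valued map relative to a set `S`. -/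
def LocallyBoundedRel {n : ℕ}
    (M : EuclideanSpace ℝ (Fin n) → Set (EuclideanSpace ℝ (Fin n)))
    (S : Set (EuclideanSpace ℝ (Fin n))) : Prop :=
  ∀ x ∈ S, ∃ U ∈ 𝓝 x, Bornology.IsBounded (⋃ y ∈ U ∩ S, M y)

/-- The data `(C, F, D, G)` of a hybrid system
`x ∈ C, ẋ ∈ F(x)`; `x ∈ D, x⁺ ∈ G(x)` on `ℝⁿ`. -/
structure HybridSystem (n : ℕ) where
  C : Set (EuclideanSpace ℝ (Fin n))
  F : EuclideanSpace ℝ (Fin n) → Set (EuclideanSpace ℝ (Fin n))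
  D : Set (EuclideanSpace ℝ (Fin n))
  G : EuclideanSpace ℝ (Fin n) → Set (EuclideanSpace ℝ (Fin n))

namespace HybridSystem

variable {n : ℕ}

/-- The hybrid basic conditions. -/
structure BasicConditions (H : HybridSystem n) : Prop where
  isClosed_C : IsClosed H.C
  isClosed_D : IsClosed H.D
  osc_F : OuterSemicontinuousRel H.F H.C
  locallyBounded_F : LocallyBoundedRel H.F H.C
  nonempty_F : ∀ x ∈ H.C, (H.F x).Nonempty
  convex_F : ∀ x ∈ H.C, Convex ℝ (H.F x)
  osc_G : OuterSemicontinuousRel H.G H.D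
  locallyBounded_G : LocallyBoundedRel H.G H.D
  nonempty_G : ∀ x ∈ H.D, (H.G x).Nonempty

/-- Solutions of the hybrid system (not necessarily maximal). -/
structure IsSolution (H : HybridSystem n) (φ : HybridArc n) : Prop where
  init_mem : φ.init ∈ closure H.C ∪ H.D
  flow_mem : ∀ j, ∀ t ∈ interior (φ.interval j), φ.toFun (t, j) ∈ H.C
  flow_deriv : ∀ j, ∀ᵐ t : ℝ, t ∈ interior (φ.interval j) →
    ∃ v ∈ H.F (φ.toFun (t, j)), HasDerivAt (fun s => φ.toFun (s, j)) v t
  jump : ∀ t j, (t, j) ∈ φ.dom → (t, j + 1) ∈ φ.dom →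
    φ.toFun (t, j) ∈ H.D ∧ φ.toFun (t, j + 1) ∈ H.G (φ.toFun (t, j))

/-- All solutions starting in `X` remain in `X`. -/
def StronglyForwardInvariant (H : HybridSystem n) (X : Set (EuclideanSpace ℝ (Fin n))) : Prop :=
  ∀ φ, H.IsSolution φ → φ.init ∈ X → ∀ p ∈ φ.dom, φ.toFun p ∈ X

/-- `X` is stable relative to `Y`. Here `Metric.thickening δ X` is `X + δ𝔹`. -/
def StableRel (H : HybridSystem n) (X Y : Set (EuclideanSpace ℝ (Fin n))) : Prop :=
  ∀ ε > 0, ∀ Δ > 0, ∃ δ > 0, ∀ φ, H.IsSolution φ → φ.init ∈ Y →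
    φ.init ∈ Metric.thickening δ X ∩ Metric.ball 0 Δ →
    ∀ p ∈ φ.dom, φ.toFun p ∈ Metric.thickening ε X

/-- All solutions that start in `(X + δ𝔹) ∩ Y` converge to `X`. -/
def AttractiveFromRel (H : HybridSystem n) (δ : ℝ) (X Y : Set (EuclideanSpace ℝ (Fin n))) :
    Prop :=
  ∀ φ, H.IsSolution φ → φ.init ∈ Y → φ.init ∈ Metric.thickening δ X → φ.ConvergesTo X

/-- `X` is (locally) attractive relative to `Y`. -/
def AttractiveRel (H : HybridSystem n) (X Y : Set (EuclideanSpace ℝ (Fin n))) : Prop :=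
  ∃ δ > 0, H.AttractiveFromRel δ X Y

/-- `X` is globally attractive relative to `Y`. -/
def GloballyAttractiveRel (H : HybridSystem n) (X Y : Set (EuclideanSpace ℝ (Fin n))) : Prop :=
  ∀ δ > 0, H.AttractiveFromRel δ X Y

/-- The basin of attraction of `X`: the largest set of initial conditions from which all
solutions converge to `X`. A solution that is not complete satisfies `ConvergesTo` for lack of
large times; such a solution is admitted only if it is bounded, so that a solution with finite
escape time does not count as converging to `X`. -/
def basin (H : HybridSystem n) (X : Set (EuclideanSpace ℝ (Fin n))) :
    Set (EuclideanSpace ℝ (Fin n)) :=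
  {x | ∀ φ, H.IsSolution φ → φ.init = x →
    (¬ φ.IsComplete → φ.IsBounded) ∧ φ.ConvergesTo X}

/-- `X` is uniformly attractive from `K`. -/
def UniformlyAttractiveFrom (H : HybridSystem n) (X K : Set (EuclideanSpace ℝ (Fin n))) : Prop :=
  ∀ ε > 0, ∃ T : ℝ, ∀ φ, H.IsSolution φ → φ.init ∈ K →
    ∀ p ∈ φ.dom, T ≤ p.1 + p.2 → Metric.infDist (φ.toFun p) X ≤ ε

/-- `X` is uniformly asymptotically stable relative to `Y`: it is stable and attractive relative
to `Y`, and uniformly attractive from each compact subset of its basin of attraction in `Y`. -/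
def UASRel (H : HybridSystem n) (X Y : Set (EuclideanSpace ℝ (Fin n))) : Prop :=
  H.StableRel X Y ∧ H.AttractiveRel X Y ∧
    ∀ K, IsCompact K → K ⊆ H.basin X ∩ Y → H.UniformlyAttractiveFrom X K

/-- `X` is uniformly globally asymptotically stable relative to `Y`. -/
def UGASRel (H : HybridSystem n) (X Y : Set (EuclideanSpace ℝ (Fin n))) : Prop :=
  H.UASRel X Y ∧ H.basin X ∩ Y = Y

/-- Solutions are uniformly bounded from the (compact) set `K`. -/
def UniformlyBoundedFrom (H : HybridSystem n) (K : Set (EuclideanSpace ℝ (Fin n))) : Prop :=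
  ∃ Δ > 0, ∀ φ, H.IsSolution φ → φ.init ∈ K → ∀ p ∈ φ.dom, ‖φ.toFun p‖ < Δ

/-- Solutions are uniformly globally bounded relative to `Y`. -/
def UGBRel (H : HybridSystem n) (Y : Set (EuclideanSpace ℝ (Fin n))) : Prop :=
  ∀ K, IsCompact K → K ⊆ Y → H.UniformlyBoundedFrom K

end HybridSystem

/-
The key is compactness of solutions: under the hybrid basic conditions, a sequence of solutions
whose initial points are bounded has a graphical limit along an ultrafilter, which is again a
solution, defined as long as the sequence stays bounded; convexity of `F` passes the flow inclusion
to the limit through difference quotients. Consequently the solutions starting in a compact set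
without finite escape are uniformly bounded on bounded hybrid time intervals.

Every claim is then an argument by contradiction with time-shifted pieces of solutions. If solutions
starting ever closer to `Mo` all left an `ε`-neighbourhood of it, cut out the piece from the last
time at distance at most `δ` to the first time at distance at least `ε`. Since `Mi` is stable, these
pieces start ever closer to `Mi`, so their limit starts in `Mi`. If their durations are bounded, the
limit also exits, against stability of `Mo` relative to `Mi`; otherwise it stays at distance at
least `δ` forever, against attractivity. In the same way, a bounded solution that converges to `Mi`
but not to `Mo` has, by stability of `Mo`, ever longer late pieces avoiding a neighbourhood of `Mo`,
and their limit starts in `Mi` and does not converge to `Mo`. Uniformity of the attraction follows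
likewise, from solutions starting in a compact subset of the basin.
-/

section AbsoluteContinuity

theorem absolutelyContinuousOnInterval_comp_of_lipschitzWith {X Y : Type*} [PseudoMetricSpace X]
    [PseudoMetricSpace Y] {g : X → Y} {K : NNReal} (hg : LipschitzWith K g) {f : ℝ → X} {a b : ℝ}
    (hf : AbsolutelyContinuousOnInterval f a b) :
    AbsolutelyContinuousOnInterval (fun t => g (f t)) a b := by
  unfold AbsolutelyContinuousOnInterval at hf ⊢
  refine squeeze_zero (fun I => Finset.sum_nonneg fun i _ => dist_nonneg) (fun I => ?_)
    (by simpa only [mul_zero] using hf.const_mul (K : ℝ))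
  rw [Finset.mul_sum]
  exact Finset.sum_le_sum fun i _ => hg.dist_le_mul _ _

theorem absolutelyContinuousOnInterval_comp_const_add {X : Type*} [PseudoMetricSpace X]
    {f : ℝ → X} {a b c : ℝ} (hf : AbsolutelyContinuousOnInterval f (c + a) (c + b)) :
    AbsolutelyContinuousOnInterval (fun t => f (c + t)) a b := by
  rw [absolutelyContinuousOnInterval_iff] at hf ⊢
  intro ε hε
  obtain ⟨δ, hδ, hsmall⟩ := hf ε hε
  refine ⟨δ, hδ, fun I hI hlen => ?_⟩
  refine hsmall (I.1, fun i => (c + (I.2 i).1, c + (I.2 i).2)) ⟨fun i hi => ?_, ?_⟩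
    (by simpa only [dist_add_left] using hlen)
  · simp only [← Set.image_const_add_uIcc]
    exact ⟨Set.mem_image_of_mem _ (hI.1 i hi).1, Set.mem_image_of_mem _ (hI.1 i hi).2⟩
  · intro i hi j hj hij
    have hdisj := hI.2 hi hj hij
    simp only [Function.onFun, Set.uIoc, min_add_add_left, max_add_add_left,
      ← Set.image_const_add_Ioc] at hdisj ⊢
    exact (Set.disjoint_image_iff (add_right_injective c)).2 hdisj

/-- A separating functional reduces the claim to the fundamental theorem of calculus for real
functions. -/
theorem inv_smul_sub_mem_of_ae_hasDerivAt {V : Type*} [NormedAddCommGroup V] [NormedSpace ℝ V]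
    {f : ℝ → V} {a b : ℝ} (hab : a < b) (hf : AbsolutelyContinuousOnInterval f a b) {S : Set V}
    (hconv : Convex ℝ S) (hclosed : IsClosed S)
    (hderiv : ∀ᵐ t : ℝ, t ∈ Set.Ioo a b → ∃ v ∈ S, HasDerivAt f v t) :
    (b - a)⁻¹ • (f b - f a) ∈ S := by
  by_contra hnot
  obtain ⟨l, u, hlS, hlu⟩ := geometric_hahn_banach_closed_point hconv hclosed hnot
  have hac : AbsolutelyContinuousOnInterval (fun t => l (f t)) a b :=
    absolutelyContinuousOnInterval_comp_of_lipschitzWith l.lipschitz hf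
  have hle : ∫ t in a..b, deriv (fun t => l (f t)) t ≤ ∫ _ in a..b, u := by
    refine intervalIntegral.integral_mono_ae_restrict hab.le hac.intervalIntegrable_deriv
      intervalIntegrable_const ?_
    rw [MeasureTheory.Measure.restrict_congr_set MeasureTheory.Ioo_ae_eq_Icc.symm, EventuallyLE,
      MeasureTheory.ae_restrict_iff' measurableSet_Ioo]
    filter_upwards [hderiv] with t ht hmem
    obtain ⟨v, hv, hfv⟩ := ht hmem
    exact (l.hasFDerivAt.comp_hasDerivAt t hfv).deriv.trans_le (hlS v hv).le
  rw [hac.integral_deriv_eq_sub, intervalIntegral.integral_const, smul_eq_mul] at hle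
  rw [map_smul, map_sub, smul_eq_mul, inv_mul_eq_div, lt_div_iff₀ (sub_pos.2 hab)] at hlu
  linarith

end AbsoluteContinuity

section UltrafilterLimits

variable {ι : Type*} {U : Ultrafilter ι}

theorem exists_tendsto_of_eventually_mem {X : Type*} [TopologicalSpace X] {K : Set X}
    (hK : IsCompact K) {u : ι → X} (hu : ∀ᶠ k in (U : Filter ι), u k ∈ K) :
    ∃ x ∈ K, Tendsto u U (𝓝 x) :=
  hK.ultrafilter_le_nhds' (U.map u) hu

theorem exists_eventually_le_or_tendsto_atTop (U : Ultrafilter ι) (u : ι → ℝ) :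
    (∃ T, ∀ᶠ k in (U : Filter ι), u k ≤ T) ∨ Tendsto u U atTop := by
  rw [or_iff_not_imp_left, tendsto_atTop]
  intro hunbdd T
  simp only [not_exists, ← Ultrafilter.eventually_not, not_le] at hunbdd
  exact (hunbdd T).mono fun k hk => hk.le

theorem tendsto_natCast_hyperfilter :
    Tendsto (Nat.cast : ℕ → ℝ) (hyperfilter ℕ : Filter ℕ) atTop :=
  tendsto_natCast_atTop_atTop.mono_left Nat.hyperfilter_le_atTop

end UltrafilterLimits

section HybridTime

theorem strictMono_fst_add_snd : StrictMono fun p : ℝ × ℕ => p.1 + (p.2 : ℝ) := by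
  intro p q hpq
  rcases Prod.lt_iff.1 hpq with ⟨hfst, hsnd⟩ | ⟨hfst, hsnd⟩
  · exact add_lt_add_of_lt_of_le hfst (Nat.cast_le.2 hsnd)
  · exact add_lt_add_of_le_of_lt hfst (Nat.cast_lt.2 hsnd)

theorem continuous_fst_add_snd : Continuous fun p : ℝ × ℕ => p.1 + (p.2 : ℝ) :=
  continuous_fst.add (continuous_of_discreteTopology.comp continuous_snd)

/-- The sequence `t` of jump times of `E` up to `p`: below `p`, the set `E` is the union of the
`[t j, t (j + 1)] × {j}` with `j ≤ p.2`. The values of `t` beyond `p.2` are normalised to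
`p.1`. -/
structure IsJumpTimes (E : Set (ℝ × ℕ)) (p : ℝ × ℕ) (t : ℕ → ℝ) : Prop where
  zero : t 0 = 0
  mono : Monotone t
  eq_fst : ∀ i, p.2 < i → t i = p.1
  mem_iff : ∀ q : ℝ × ℕ, (q ∈ E ∧ q ≤ p) ↔ (q.2 ≤ p.2 ∧ t q.2 ≤ q.1 ∧ q.1 ≤ t (q.2 + 1))

namespace IsJumpTimes

variable {E : Set (ℝ × ℕ)} {p : ℝ × ℕ} {t : ℕ → ℝ}

theorem le_fst (ht : IsJumpTimes E p t) (i : ℕ) : t i ≤ p.1 :=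
  (ht.mono (Nat.le_add_right i (p.2 + 1))).trans (ht.eq_fst _ (by omega)).le

theorem nonneg (ht : IsJumpTimes E p t) (i : ℕ) : 0 ≤ t i :=
  ht.zero.ge.trans (ht.mono (Nat.zero_le i))

theorem left_mem (ht : IsJumpTimes E p t) {i : ℕ} (hi : i ≤ p.2) : (t i, i) ∈ E :=
  ((ht.mem_iff (t i, i)).2 ⟨hi, le_rfl, ht.mono i.le_succ⟩).1

theorem right_mem (ht : IsJumpTimes E p t) {i : ℕ} (hi : i ≤ p.2) : (t (i + 1), i) ∈ E :=
  ((ht.mem_iff (t (i + 1), i)).2 ⟨hi, ht.mono i.le_succ, le_rfl⟩).1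

theorem isCompactHybridTimeDomain (ht : IsJumpTimes E p t) (hE : ∀ q ∈ E, 0 ≤ q.1) :
    IsCompactHybridTimeDomain (E ∩ {q | 0 ≤ q.1 ∧ q.1 ≤ p.1 ∧ q.2 ≤ p.2}) := by
  refine ⟨p.2 + 1, t, ht.zero, ht.mono, Set.ext fun q => ?_⟩
  simp only [Set.mem_inter_iff, Set.mem_ofPred_eq, Nat.lt_succ_iff]
  rw [← ht.mem_iff, Prod.le_def]
  exact ⟨fun h => ⟨h.1, h.2.2⟩, fun h => ⟨h.1, hE q h.1, h.2⟩⟩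

theorem inter_Iic (ht : IsJumpTimes E p t) {q : ℝ × ℕ} (hpq : p ≤ q) :
    IsJumpTimes (E ∩ Set.Iic q) p t where
  zero := ht.zero
  mono := ht.mono
  eq_fst := ht.eq_fst
  mem_iff r := (and_congr_left fun hr => and_iff_left (hr.trans hpq)).trans (ht.mem_iff r)

theorem tail {s q : ℝ × ℕ} (ht : IsJumpTimes E (s + q) t) (hs : s ∈ E) (hq : 0 ≤ q.1) :
    IsJumpTimes {r | 0 ≤ r.1 ∧ s + r ∈ E} q fun i => max (t (s.2 + i)) s.1 - s.1 := by
  obtain ⟨-, hts, hst⟩ := (ht.mem_iff s).1 ⟨hs, le_add_of_nonneg_right ⟨hq, Nat.zero_le _⟩⟩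
  refine ⟨by simp [hts], fun i k hik => ?_, fun i hi => ?_, fun r => ?_⟩
  · have := ht.mono (Nat.add_le_add_left hik s.2)
    gcongr
  · rw [ht.eq_fst _ (by simpa using hi)]
    simp [hq]
  · have hr := ht.mem_iff (s + r)
    have hsr : s.1 ≤ t (s.2 + (r.2 + 1)) := hst.trans (ht.mono (by omega))
    simp only [Prod.snd_add, Prod.fst_add, add_le_add_iff_left] at hr
    simp only [Set.mem_ofPred_eq, max_eq_left hsr, sub_le_iff_le_add', le_sub_iff_add_le',
      max_le_iff, le_add_iff_nonneg_right, and_assoc, and_comm (a := 0 ≤ r.1)]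
    rw [← add_assoc s.2]
    tauto

end IsJumpTimes

theorem isHybridTimeDomain_of_isJumpTimes {E : Set (ℝ × ℕ)}
    (h : ∀ p ∈ E, ∃ t, IsJumpTimes E p t) : IsHybridTimeDomain E := by
  have hnonneg : ∀ p ∈ E, 0 ≤ p.1 := fun p hp =>
    let ⟨_, ht⟩ := h p hp
    (ht.nonneg 0).trans (ht.le_fst 0)
  exact ⟨hnonneg, fun p hp =>
    let ⟨_, ht⟩ := h p hp
    ht.isCompactHybridTimeDomain hnonneg⟩

namespace IsHybridTimeDomain

variable {E : Set (ℝ × ℕ)} {p q : ℝ × ℕ}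

theorem exists_isJumpTimes (hE : IsHybridTimeDomain E) (hp : p ∈ E) :
    ∃ t, IsJumpTimes E p t := by
  obtain ⟨J, t, hzero, hmono, hEt⟩ := hE.2 p hp
  have hmem : ∀ q : ℝ × ℕ, (q ∈ E ∧ q ≤ p) ↔ (q.2 < J ∧ t q.2 ≤ q.1 ∧ q.1 ≤ t (q.2 + 1)) := by
    intro q
    rw [show (q.2 < J ∧ _) = _ from (congrArg (q ∈ ·) hEt).symm, Prod.le_def]
    exact ⟨fun h => ⟨h.1, hE.1 q h.1, h.2⟩, fun h => ⟨h.1, h.2.2⟩⟩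
  obtain ⟨hpJ, -, hp_le⟩ := (hmem p).1 ⟨hp, le_rfl⟩
  obtain rfl : J = p.2 + 1 := by
    refine le_antisymm (not_lt.1 fun hlt => ?_) hpJ
    exact absurd ((hmem (t (p.2 + 1), p.2 + 1)).2 ⟨hlt, le_rfl, hmono (Nat.le_succ _)⟩).2.2
      (Nat.not_succ_le_self _)
  have heq : t (p.2 + 1) = p.1 :=
    ((hmem (t (p.2 + 1), p.2)).2 ⟨hpJ, hmono (Nat.le_succ _), le_rfl⟩).2.1.antisymm hp_le
  have hmin : ∀ i ≤ p.2 + 1, min (t i) p.1 = t i := fun i hi => min_eq_left (heq ▸ hmono hi)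
  refine ⟨fun i => min (t i) p.1, (hmin 0 (Nat.zero_le _)).trans hzero,
    hmono.min monotone_const, fun i hi => min_eq_right (heq ▸ hmono hi), fun q => ?_⟩
  rw [hmem, Nat.lt_succ_iff]
  refine and_congr_right fun hq => ?_
  rw [hmin _ (by omega), hmin _ (by omega)]

theorem zero_mem (hE : IsHybridTimeDomain E) (hp : p ∈ E) : (0 : ℝ × ℕ) ∈ E := by
  obtain ⟨t, ht⟩ := hE.exists_isJumpTimes hp
  have h := ht.left_mem (Nat.zero_le _)
  rwa [ht.zero] at h

theorem zero_le (hE : IsHybridTimeDomain E) (hp : p ∈ E) : 0 ≤ p :=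
  ⟨hE.1 p hp, Nat.zero_le _⟩

theorem mem_of_mem_Icc (hE : IsHybridTimeDomain E) {a b s : ℝ} {j : ℕ} (ha : (a, j) ∈ E)
    (hb : (b, j) ∈ E) (hs : s ∈ Set.Icc a b) : (s, j) ∈ E := by
  obtain ⟨t, ht⟩ := hE.exists_isJumpTimes hb
  have ha' := (ht.mem_iff (a, j)).1 ⟨ha, hs.1.trans hs.2, le_rfl⟩
  exact ((ht.mem_iff (s, j)).2
    ⟨le_rfl, ha'.2.1.trans hs.1, hs.2.trans (ht.eq_fst _ (Nat.lt_succ_self j)).ge⟩).1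

theorem isChain (hE : IsHybridTimeDomain E) (hp : IsGreatest E p) : IsChain (· ≤ ·) E := by
  obtain ⟨t, ht⟩ := hE.exists_isJumpTimes hp.1
  have hjump : ∀ q ∈ E, ∀ r ∈ E, q.2 < r.2 → q ≤ r := fun q hq r hr hqr =>
    ⟨(((ht.mem_iff q).1 ⟨hq, hp.2 hq⟩).2.2.trans (ht.mono hqr)).trans
      ((ht.mem_iff r).1 ⟨hr, hp.2 hr⟩).2.1, hqr.le⟩
  intro q hq r hr _
  rcases lt_trichotomy q.2 r.2 with hqr | hqr | hqr
  · exact Or.inl (hjump q hq r hr hqr)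
  · exact (le_total q.1 r.1).imp (fun hle => ⟨hle, hqr.le⟩) fun hle => ⟨hle, hqr.ge⟩
  · exact Or.inr (hjump r hr q hq hqr)

theorem exists_jump (hE : IsHybridTimeDomain E) (hp : p ∈ E) (hq : q ∈ E) (hqp : q ≤ p)
    (hlt : q.2 < p.2) :
    ∃ s ∈ Set.Icc q.1 p.1, (s, q.2) ∈ E ∧ (s, q.2 + 1) ∈ E := by
  obtain ⟨t, ht⟩ := hE.exists_isJumpTimes hp
  exact ⟨t (q.2 + 1), ⟨((ht.mem_iff q).1 ⟨hq, hqp⟩).2.2, ht.le_fst _⟩, ht.right_mem hlt.le,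
    ht.left_mem hlt⟩

theorem eq_zero_or_flow_or_jump (hE : IsHybridTimeDomain E) (hp : p ∈ E) :
    p = 0 ∨ (∃ s < p.1, (s, p.2) ∈ E) ∨ ∃ i, p.2 = i + 1 ∧ (p.1, i) ∈ E := by
  obtain ⟨t, ht⟩ := hE.exists_isJumpTimes hp
  rcases (ht.le_fst p.2).lt_or_eq with hlt | heq
  · exact Or.inr (Or.inl ⟨t p.2, hlt, ht.left_mem le_rfl⟩)
  · rcases hj : p.2 with _ | i
    · exact Or.inl (Prod.ext (by rw [← heq, hj, ht.zero]; rfl) hj)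
    · rw [hj] at heq
      exact Or.inr (Or.inr ⟨i, rfl, heq ▸ ht.right_mem (by omega)⟩)

theorem isCompact_inter_Iic (hE : IsHybridTimeDomain E) (hp : p ∈ E) :
    IsCompact (E ∩ Set.Iic p) := by
  obtain ⟨t, ht⟩ := hE.exists_isJumpTimes hp
  have hclosed : IsClosed (E ∩ Set.Iic p) := by
    rw [show E ∩ Set.Iic p = _ from Set.ext ht.mem_iff]
    have hcont : ∀ g : ℕ → ℝ, Continuous fun q : ℝ × ℕ => g q.2 :=
      fun g => continuous_of_discreteTopology.comp continuous_snd
    exact (isClosed_le continuous_snd continuous_const).inter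
      ((isClosed_le (hcont t) continuous_fst).inter
        (isClosed_le continuous_fst (hcont fun i => t (i + 1))))
  exact (isCompact_Icc (a := (0 : ℝ × ℕ)) (b := p)).of_isClosed_subset hclosed
    fun q hq => ⟨hE.zero_le hq.1, hq.2⟩

/-- A hybrid time of length at least `T` and of least such length below `p` has length at most
`T + 1`, since the length grows continuously along flows and by one at jumps. -/
theorem exists_length_mem_Icc (hE : IsHybridTimeDomain E) (hp : p ∈ E) {T : ℝ} (hT : 0 ≤ T)
    (hTp : T ≤ p.1 + p.2) :
    ∃ q ∈ E, q ≤ p ∧ q.1 + (q.2 : ℝ) ∈ Set.Icc T (T + 1) := by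
  have hK : IsCompact ((E ∩ Set.Iic p) ∩ {q : ℝ × ℕ | T ≤ q.1 + (q.2 : ℝ)}) :=
    (hE.isCompact_inter_Iic hp).inter_right
      (isClosed_le continuous_const continuous_fst_add_snd)
  obtain ⟨q, ⟨⟨hq, hqp⟩, hTq⟩, hmin⟩ :=
    hK.exists_isMinOn ⟨p, ⟨hp, Set.mem_Iic.2 le_rfl⟩, hTp⟩ continuous_fst_add_snd.continuousOn
  refine ⟨q, hq, hqp, hTq, not_lt.1 fun hlt => ?_⟩
  have hmin_lt : ∀ r ∈ E, r < q → r.1 + (r.2 : ℝ) < T := fun r hr hrq => not_le.1 fun hTr =>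
    (strictMono_fst_add_snd hrq).not_ge (hmin ⟨⟨hr, hrq.le.trans hqp⟩, hTr⟩)
  rcases hE.eq_zero_or_flow_or_jump hq with rfl | ⟨s, hs, hsE⟩ | ⟨i, hi, hiE⟩
  · simp only [Prod.fst_zero, Prod.snd_zero, Nat.cast_zero, add_zero] at hlt
    linarith
  · have hlt' : max s (T - q.2) < q.1 := max_lt hs (by linarith)
    have := hmin_lt _ (hE.mem_of_mem_Icc hsE hq ⟨le_max_left _ _, hlt'.le⟩)
      (Prod.lt_iff.2 (Or.inl ⟨hlt', le_rfl⟩))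
    linarith [le_max_right s (T - q.2)]
  · have := hmin_lt _ hiE (Prod.lt_iff.2 (Or.inr ⟨le_rfl, by simp only; omega⟩))
    rw [hi] at hlt
    push_cast at hlt
    linarith

theorem exists_lt_le_length_sub (hE : IsHybridTimeDomain E) (hp : p ∈ E) {T : ℝ} (hT : 0 ≤ T)
    (hTp : 2 * T + 2 ≤ p.1 + p.2) :
    ∃ s ∈ E, s < p ∧ T ≤ s.1 + (s.2 : ℝ) ∧ T ≤ (p - s).1 + ((p - s).2 : ℝ) := by
  obtain ⟨s, hs, hsp, hTs, hsT⟩ := hE.exists_length_mem_Icc hp hT (by linarith)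
  have hlen : p.1 + (p.2 : ℝ) = s.1 + s.2 + ((p - s).1 + ((p - s).2 : ℝ)) := by
    conv_lhs => rw [← add_tsub_cancel_of_le hsp]
    simp only [Prod.fst_add, Prod.snd_add, Nat.cast_add]
    ring
  refine ⟨s, hs, lt_of_le_of_ne hsp ?_, hTs, by linarith⟩
  rintro rfl
  linarith

end IsHybridTimeDomain

end HybridTime

namespace HybridArc

variable {n : ℕ} {φ : HybridArc n} {p s : ℝ × ℕ}

theorem zero_mem_dom (φ : HybridArc n) : 0 ∈ φ.dom :=
  φ.isHybridTimeDomain.zero_mem φ.dom_nonempty.some_mem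

theorem convergesTo_iff {X : Set (EuclideanSpace ℝ (Fin n))} :
    φ.ConvergesTo X ↔ ∀ ε > 0, ∃ T : ℝ, ∀ p ∈ φ.dom, T ≤ p.1 + (p.2 : ℝ) →
      Metric.infDist (φ.toFun p) X < ε := by
  unfold ConvergesTo
  rw [((atTop_basis.comap _).inf_principal φ.dom).tendsto_iff Metric.nhds_basis_ball]
  simp only [true_and, Metric.mem_ball, Real.dist_eq, sub_zero,
    abs_of_nonneg Metric.infDist_nonneg]
  exact forall₂_congr fun ε _ => exists_congr fun T =>
    ⟨fun h p hp hT => h p ⟨hT, hp⟩, fun h p hp => h p hp.2 hp.1⟩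

section FirstAndLastTimes

theorem continuousOn_inter_Iic (φ : HybridArc n) (hp : p ∈ φ.dom) :
    ContinuousOn φ.toFun (φ.dom ∩ Set.Iic p) := by
  rw [continuousOn_prod_of_discrete_right]
  intro j
  obtain ⟨t, ht⟩ := φ.isHybridTimeDomain.exists_isJumpTimes hp
  by_cases hj : j ≤ p.2
  · have hac := φ.locallyAbsolutelyContinuous j _ _ (ht.left_mem hj) (ht.right_mem hj)
    refine hac.continuousOn.mono fun s hs => ?_
    rw [Set.uIcc_of_le (ht.mono j.le_succ)]
    exact ((ht.mem_iff (s, j)).1 hs).2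
  · exact fun s hs => absurd hs.2.2 hj

theorem isCompact_inter_Iic_inter_preimage (φ : HybridArc n) (hp : p ∈ φ.dom)
    {A : Set (EuclideanSpace ℝ (Fin n))} (hA : IsClosed A) :
    IsCompact ((φ.dom ∩ Set.Iic p) ∩ φ.toFun ⁻¹' A) :=
  have hK := φ.isHybridTimeDomain.isCompact_inter_Iic hp
  hK.of_isClosed_subset
    ((φ.continuousOn_inter_Iic hp).preimage_isClosed_of_isClosed hK.isClosed hA)
    Set.inter_subset_left

theorem exists_first_mem (φ : HybridArc n) (hp : p ∈ φ.dom)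
    {A : Set (EuclideanSpace ℝ (Fin n))} (hA : IsClosed A) (hpA : φ.toFun p ∈ A) :
    ∃ q ∈ φ.dom, q ≤ p ∧ φ.toFun q ∈ A ∧ ∀ r ∈ φ.dom, r < q → φ.toFun r ∉ A := by
  obtain ⟨q, ⟨⟨hq, hqp⟩, hqA⟩, hmin⟩ :=
    (φ.isCompact_inter_Iic_inter_preimage hp hA).exists_isMinOn
      ⟨p, ⟨hp, Set.mem_Iic.2 le_rfl⟩, hpA⟩ continuous_fst_add_snd.continuousOn
  exact ⟨q, hq, hqp, hqA, fun r hr hrq hrA =>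
    (strictMono_fst_add_snd hrq).not_ge (hmin ⟨⟨hr, hrq.le.trans hqp⟩, hrA⟩)⟩

theorem exists_last_mem (φ : HybridArc n) (hp : p ∈ φ.dom)
    {A : Set (EuclideanSpace ℝ (Fin n))} (hA : IsClosed A) (hs : s ∈ φ.dom) (hsp : s ≤ p)
    (hsA : φ.toFun s ∈ A) :
    ∃ q ∈ φ.dom, q ≤ p ∧ φ.toFun q ∈ A ∧ ∀ r ∈ φ.dom, r ≤ p → q < r → φ.toFun r ∉ A := by
  obtain ⟨q, ⟨⟨hq, hqp⟩, hqA⟩, hmax⟩ :=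
    (φ.isCompact_inter_Iic_inter_preimage hp hA).exists_isMaxOn
      ⟨s, ⟨hs, hsp⟩, hsA⟩ continuous_fst_add_snd.continuousOn
  exact ⟨q, hq, hqp, hqA, fun r hr hrp hqr hrA =>
    (strictMono_fst_add_snd hqr).not_ge (hmax ⟨⟨hr, hrp⟩, hrA⟩)⟩

theorem exists_exit_interval (φ : HybridArc n) {g : EuclideanSpace ℝ (Fin n) → ℝ}
    (hg : Continuous g) {δ ε : ℝ} (hδε : δ < ε) (hinit : g φ.init ≤ δ) (hp : p ∈ φ.dom)
    (hpε : ε ≤ g (φ.toFun p)) :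
    ∃ s ∈ φ.dom, ∃ q ∈ φ.dom, s < q ∧ g (φ.toFun s) ≤ δ ∧ ε ≤ g (φ.toFun q) ∧
      ∀ r ∈ φ.dom, s < r → r < q → g (φ.toFun r) ∈ Set.Ioo δ ε := by
  obtain ⟨q, hq, -, hqε, hbefore⟩ :=
    φ.exists_first_mem hp (isClosed_le continuous_const hg : IsClosed {x | ε ≤ g x}) hpε
  obtain ⟨s, hs, hsq, hsδ, hafter⟩ :=
    φ.exists_last_mem hq (isClosed_le hg continuous_const : IsClosed {x | g x ≤ δ})
      φ.zero_mem_dom (φ.isHybridTimeDomain.zero_le hq) hinit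
  have hne : s ≠ q := by
    rintro rfl
    exact hδε.not_ge (le_trans hqε hsδ)
  exact ⟨s, hs, q, hq, lt_of_le_of_ne hsq hne, hsδ, hqε, fun r hr hsr hrq =>
    ⟨not_le.1 (hafter r hr hrq.le hsr), not_le.1 (hbefore r hr hrq)⟩⟩

end FirstAndLastTimes

section Restriction

/-- The restriction of an arc to the hybrid times up to `p`. Hybrid time domains in the sense of
`IsHybridTimeDomain` need not be totally ordered (`[0, 1] × {0} ∪ {(0, 1)}` is one), so this is
also how an arc is given a greatest time. -/
def truncate (φ : HybridArc n) (p : ℝ × ℕ) (hp : p ∈ φ.dom) : HybridArc n where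
  dom := φ.dom ∩ Set.Iic p
  toFun := φ.toFun
  dom_nonempty := ⟨p, hp, Set.mem_Iic.2 le_rfl⟩
  isHybridTimeDomain := isHybridTimeDomain_of_isJumpTimes fun _ hq =>
    let ⟨t, ht⟩ := φ.isHybridTimeDomain.exists_isJumpTimes hq.1
    ⟨t, ht.inter_Iic hq.2⟩
  locallyAbsolutelyContinuous j a b ha hb := φ.locallyAbsolutelyContinuous j a b ha.1 hb.1

/-- The arc seen from the hybrid time `s` on, with `s` as the new origin of time. -/
def tail (φ : HybridArc n) (s : ℝ × ℕ) (hs : s ∈ φ.dom) : HybridArc n where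
  dom := {q | 0 ≤ q.1 ∧ s + q ∈ φ.dom}
  toFun q := φ.toFun (s + q)
  dom_nonempty := ⟨0, le_rfl, by rwa [add_zero]⟩
  isHybridTimeDomain := isHybridTimeDomain_of_isJumpTimes fun q hq => by
    obtain ⟨t, ht⟩ := φ.isHybridTimeDomain.exists_isJumpTimes hq.2
    exact ⟨_, ht.tail hs hq.1⟩
  locallyAbsolutelyContinuous j a b ha hb :=
    absolutelyContinuousOnInterval_comp_const_add (f := fun t => φ.toFun (t, s.2 + j))
      (φ.locallyAbsolutelyContinuous (s.2 + j) (s.1 + a) (s.1 + b) ha.2 hb.2)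

/-- The portion of an arc between the hybrid times `s` and `p`, with `s` as the new origin of
time. -/
def segment (φ : HybridArc n) (s p : ℝ × ℕ) (hs : s ∈ φ.dom) (hp : p ∈ φ.dom) (hsp : s ≤ p) :
    HybridArc n :=
  (φ.truncate p hp).tail s ⟨hs, hsp⟩

theorem isGreatest_truncate_dom (hp : p ∈ φ.dom) : IsGreatest (φ.truncate p hp).dom p :=
  ⟨⟨hp, Set.mem_Iic.2 le_rfl⟩, fun _ hq => hq.2⟩

theorem init_tail (hs : s ∈ φ.dom) : (φ.tail s hs).init = φ.toFun s :=
  congrArg φ.toFun (add_zero s)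

variable (hs : s ∈ φ.dom) (hp : p ∈ φ.dom) (hsp : s ≤ p)

theorem init_segment : (φ.segment s p hs hp hsp).init = φ.toFun s :=
  init_tail _

theorem add_mem_of_mem_segment_dom {r : ℝ × ℕ} (hr : r ∈ (φ.segment s p hs hp hsp).dom) :
    s + r ∈ φ.dom :=
  hr.2.1

theorem isGreatest_segment_dom : IsGreatest (φ.segment s p hs hp hsp).dom (p - s) := by
  have hadd : s + (p - s) = p := add_tsub_cancel_of_le hsp
  refine ⟨⟨sub_nonneg.2 hsp.1, ?_⟩, fun r hr => ?_⟩
  · rw [hadd]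
    exact ⟨hp, Set.mem_Iic.2 le_rfl⟩
  · have hr_le : s + r ≤ s + (p - s) := hr.2.2.trans hadd.ge
    exact le_of_add_le_add_left hr_le

theorem segment_toFun_sub : (φ.segment s p hs hp hsp).toFun (p - s) = φ.toFun p :=
  congrArg φ.toFun (add_tsub_cancel_of_le hsp)

theorem add_mem_Ioo_of_mem_segment_dom {r : ℝ × ℕ} (hr : r ∈ (φ.segment s p hs hp hsp).dom)
    (hr_ne : r ≠ 0) (hr_ne' : r ≠ p - s) : s + r ∈ Set.Ioo s p := by
  have hr_pos : 0 < r :=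
    lt_of_le_of_ne ((φ.segment s p hs hp hsp).isHybridTimeDomain.zero_le hr) hr_ne.symm
  refine ⟨lt_add_of_pos_right s hr_pos, lt_of_le_of_ne hr.2.2 ?_⟩
  rintro rfl
  exact hr_ne' (add_tsub_cancel_left s r).symm

end Restriction

theorem Icc_subset_interval {a b : ℝ} {j : ℕ} (ha : (a, j) ∈ φ.dom) (hb : (b, j) ∈ φ.dom) :
    Set.Icc a b ⊆ φ.interval j :=
  fun _ ht => φ.isHybridTimeDomain.mem_of_mem_Icc ha hb ht

theorem Ioo_subset_interior_interval {a b : ℝ} {j : ℕ} (ha : (a, j) ∈ φ.dom)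
    (hb : (b, j) ∈ φ.dom) : Set.Ioo a b ⊆ interior (φ.interval j) :=
  interior_maximal (Set.Ioo_subset_Icc_self.trans (Icc_subset_interval ha hb)) isOpen_Ioo

theorem toFun_mem_closure_image_Ioo {a b t : ℝ} {j : ℕ} (ha : (a, j) ∈ φ.dom)
    (hb : (b, j) ∈ φ.dom) (hab : a < b) (ht : t ∈ Set.Icc a b) :
    φ.toFun (t, j) ∈ closure ((fun s => φ.toFun (s, j)) '' Set.Ioo a b) := by
  have hcont := (φ.locallyAbsolutelyContinuous j a b ha hb).continuousOn
  rw [Set.uIcc_of_le hab.le, ← closure_Ioo hab.ne] at hcont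
  rw [← closure_Ioo hab.ne] at ht
  exact hcont.image_closure (Set.mem_image_of_mem _ ht)

theorem ae_differentiableAt (φ : HybridArc n) (j : ℕ) :
    ∀ᵐ t : ℝ, t ∈ interior (φ.interval j) →
      DifferentiableAt ℝ (fun s => φ.toFun (s, j)) t := by
  have hrat : ∀ᵐ t : ℝ, ∀ a b : ℚ, (a : ℝ) ∈ φ.interval j → (b : ℝ) ∈ φ.interval j →
      t ∈ Set.uIcc (a : ℝ) b → DifferentiableAt ℝ (fun s => φ.toFun (s, j)) t := by
    simp only [MeasureTheory.ae_all_iff]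
    intro a b ha hb
    exact (φ.locallyAbsolutelyContinuous j a b ha
      hb).boundedVariationOn.ae_differentiableAt_of_mem_uIcc
  filter_upwards [hrat] with t ht hmem
  obtain ⟨ε, hε, hball⟩ := Metric.mem_nhds_iff.1 (mem_interior_iff_mem_nhds.1 hmem)
  rw [Real.ball_eq_Ioo] at hball
  obtain ⟨a, hεa, hat⟩ := exists_rat_btwn (sub_lt_self t hε)
  obtain ⟨b, htb, hbε⟩ := exists_rat_btwn (lt_add_of_pos_right t hε)
  exact ht a b (hball ⟨hεa, by linarith⟩) (hball ⟨by linarith, hbε⟩)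
    (Set.Icc_subset_uIcc ⟨hat.le, htb.le⟩)

end HybridArc

section SetValuedMaps

variable {n : ℕ} {M : EuclideanSpace ℝ (Fin n) → Set (EuclideanSpace ℝ (Fin n))}
  {S : Set (EuclideanSpace ℝ (Fin n))}

theorem LocallyBoundedRel.exists_norm_le (hM : LocallyBoundedRel M S) (hS : IsClosed S) (R : ℝ) :
    ∃ L, ∀ x ∈ S, ‖x‖ ≤ R → ∀ v ∈ M x, ‖v‖ ≤ L := by
  have hK : IsCompact (S ∩ Metric.closedBall 0 R) := (isCompact_closedBall 0 R).inter_left hS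
  have hbdd : Bornology.IsBounded (⋃ x ∈ (S ∩ Metric.closedBall 0 R) ∩ S, M x) := by
    refine hK.induction_on (p := fun A => Bornology.IsBounded (⋃ x ∈ A ∩ S, M x))
      (by simp) (fun A B hAB hB => hB.subset ?_) (fun A B hA hB => ?_) (fun x hx => ?_)
    · exact Set.biUnion_subset_biUnion_left (Set.inter_subset_inter_left _ hAB)
    · rw [Set.union_inter_distrib_right, Set.biUnion_union]
      exact hA.union hB
    · obtain ⟨W, hW, hWbdd⟩ := hM x hx.1
      exact ⟨W, mem_nhdsWithin_of_mem_nhds hW, hWbdd⟩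
  obtain ⟨L, hL⟩ := hbdd.exists_norm_le
  exact ⟨L, fun x hx hxR v hv =>
    hL v (Set.mem_biUnion ⟨⟨hx, mem_closedBall_zero_iff.2 hxR⟩, hx⟩ hv)⟩

namespace OuterSemicontinuousRel

theorem mem_of_tendsto (hM : OuterSemicontinuousRel M S) {ι : Type*} {l : Filter ι} [l.NeBot]
    {u v : ι → EuclideanSpace ℝ (Fin n)} {x y : EuclideanSpace ℝ (Fin n)} (hx : x ∈ S)
    (hu : ∀ᶠ k in l, u k ∈ S) (hv : ∀ᶠ k in l, v k ∈ M (u k)) (hux : Tendsto u l (𝓝 x))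
    (hvy : Tendsto v l (𝓝 y)) : y ∈ M x := by
  have hfreq : ∃ᶠ z in 𝓝 (x, y), z.1 ∈ S ∧ z.2 ∈ M z.1 :=
    (hux.prodMk_nhds hvy).frequently (hu.and hv).frequently
  obtain ⟨z, hz, hzM⟩ := exists_seq_forall_of_frequently hfreq
  exact hM x hx _ _ y (fun k => (hzM k).1) (fun k => (hzM k).2) hz.fst_nhds hz.snd_nhds

theorem isClosed (hM : OuterSemicontinuousRel M S) {x : EuclideanSpace ℝ (Fin n)} (hx : x ∈ S) :
    IsClosed (M x) :=
  IsSeqClosed.isClosed fun v y hv hy =>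
    hM x hx (fun _ => x) v y (fun _ => hx) hv tendsto_const_nhds hy

theorem eventually_subset_thickening (hM : OuterSemicontinuousRel M S)
    (hbdd : LocallyBoundedRel M S) {x : EuclideanSpace ℝ (Fin n)} (hx : x ∈ S) {ε : ℝ}
    (hε : 0 < ε) : ∀ᶠ y in 𝓝[S] x, M y ⊆ Metric.thickening ε (M x) := by
  by_contra hcon
  obtain ⟨u, hux, hu⟩ := exists_seq_forall_of_frequently (not_eventually.1 hcon)
  choose v hv hv_far using fun k => Set.not_subset.1 (hu k)
  rw [tendsto_nhdsWithin_iff] at hux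
  obtain ⟨W, hW, hWbdd⟩ := hbdd x hx
  have hvW : ∀ᶠ k in atTop, v k ∈ ⋃ y ∈ W ∩ S, M y := by
    filter_upwards [hux.1 hW, hux.2] with k hkW hkS
    exact Set.mem_biUnion (⟨hkW, hkS⟩ : u k ∈ W ∩ S) (hv k)
  obtain ⟨y, -, κ, hκ, hlim⟩ := tendsto_subseq_of_frequently_bounded hWbdd hvW.frequently
  have hy : y ∈ M x := hM.mem_of_tendsto hx (hκ.tendsto_atTop.eventually hux.2)
    (Eventually.of_forall fun k => hv (κ k)) (hux.1.comp hκ.tendsto_atTop) hlim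
  obtain ⟨k, hk⟩ := (Metric.tendsto_nhds.1 hlim ε hε).exists
  exact hv_far _ (Metric.mem_thickening_iff.2 ⟨y, hy, hk⟩)

end OuterSemicontinuousRel

end SetValuedMaps

namespace HybridSystem

namespace IsSolution

variable {n : ℕ} {H : HybridSystem n} {φ : HybridArc n} {s p : ℝ × ℕ}

section Restriction

theorem truncate (hφ : H.IsSolution φ) (hp : p ∈ φ.dom) : H.IsSolution (φ.truncate p hp) where
  init_mem := hφ.init_mem
  flow_mem j t ht := hφ.flow_mem j t (interior_mono (fun _ h => h.1) ht)
  flow_deriv j := (hφ.flow_deriv j).mono fun _ h ht => h (interior_mono (fun _ h => h.1) ht)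
  jump t j hj hj' := hφ.jump t j hj.1 hj'.1

theorem mem_closure_of_lt (hφ : H.IsSolution φ) (hs : s ∈ φ.dom) (hp : p ∈ φ.dom)
    (hsp : s < p) : φ.toFun s ∈ closure H.C ∪ H.D := by
  have hflow : ∀ r > s.1, (r, s.2) ∈ φ.dom → φ.toFun s ∈ closure H.C := by
    intro r hr hrE
    refine closure_mono ?_
      (HybridArc.toFun_mem_closure_image_Ioo hs hrE hr (Set.left_mem_Icc.2 hr.le))
    rintro _ ⟨t, ht, rfl⟩
    exact hφ.flow_mem _ t (HybridArc.Ioo_subset_interior_interval hs hrE ht)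
  rcases hsp.le.2.lt_or_eq with hlt | heq
  · obtain ⟨r, ⟨hsr, -⟩, hrE, hrE'⟩ := φ.isHybridTimeDomain.exists_jump hp hs hsp.le hlt
    rcases hsr.lt_or_eq with hlt' | rfl
    · exact Or.inl (hflow r hlt' hrE)
    · exact Or.inr (hφ.jump _ _ hrE hrE').1
  · have hlt : s.1 < p.1 := lt_of_le_of_ne hsp.le.1 fun h => hsp.ne (Prod.ext h heq)
    exact Or.inl (hflow p.1 hlt (heq ▸ hp))

theorem tail (hφ : H.IsSolution φ) (hs : s ∈ φ.dom) (hp : p ∈ φ.dom) (hsp : s < p) :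
    H.IsSolution (φ.tail s hs) := by
  have hint : ∀ j t, t ∈ interior ((φ.tail s hs).interval j) →
      s.1 + t ∈ interior (φ.interval (s.2 + j)) := by
    intro j t ht
    have hsub : (s.1 + ·) '' interior ((φ.tail s hs).interval j) ⊆ φ.interval (s.2 + j) := by
      rintro _ ⟨r, hr, rfl⟩
      exact (interior_subset hr : r ∈ (φ.tail s hs).interval j).2
    exact interior_maximal hsub (isOpenMap_add_left s.1 _ isOpen_interior) ⟨t, ht, rfl⟩
  refine ⟨?_, fun j t ht => hφ.flow_mem _ _ (hint j t ht), fun j => ?_,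
    fun t j hj hj' => hφ.jump (s.1 + t) (s.2 + j) hj.2 hj'.2⟩
  · rw [HybridArc.init_tail]
    exact hφ.mem_closure_of_lt hs hp hsp
  · filter_upwards [(MeasureTheory.measurePreserving_add_left MeasureTheory.volume
      s.1).quasiMeasurePreserving.ae (hφ.flow_deriv (s.2 + j))] with t hderiv ht
    obtain ⟨v, hv, hφv⟩ := hderiv (hint j t ht)
    exact ⟨v, hv, hφv.comp_const_add s.1 t⟩

theorem segment (hφ : H.IsSolution φ) (hs : s ∈ φ.dom) (hp : p ∈ φ.dom) (hsp : s < p) :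
    H.IsSolution (φ.segment s p hs hp hsp.le) :=
  (hφ.truncate hp).tail _ (HybridArc.isGreatest_truncate_dom hp).1 hsp

end Restriction

section Bounds

theorem inv_smul_sub_mem (hφ : H.IsSolution φ) {a b : ℝ} {j : ℕ} (hab : a < b)
    (ha : (a, j) ∈ φ.dom) (hb : (b, j) ∈ φ.dom) {S : Set (EuclideanSpace ℝ (Fin n))}
    (hconv : Convex ℝ S) (hclosed : IsClosed S)
    (hF : ∀ t ∈ Set.Ioo a b, φ.toFun (t, j) ∈ H.C → H.F (φ.toFun (t, j)) ⊆ S) :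
    (b - a)⁻¹ • (φ.toFun (b, j) - φ.toFun (a, j)) ∈ S := by
  refine inv_smul_sub_mem_of_ae_hasDerivAt hab (φ.locallyAbsolutelyContinuous j a b ha hb)
    hconv hclosed ?_
  filter_upwards [hφ.flow_deriv j] with t hderiv ht
  have hint := HybridArc.Ioo_subset_interior_interval ha hb ht
  obtain ⟨v, hv, hφv⟩ := hderiv hint
  exact ⟨v, hF t ht (hφ.flow_mem j t hint) hv, hφv⟩

theorem norm_sub_le (hφ : H.IsSolution φ) {R L : ℝ}
    (hL : ∀ x ∈ H.C, ‖x‖ ≤ R → ∀ v ∈ H.F x, ‖v‖ ≤ L) {a b : ℝ} {j : ℕ} (hab : a ≤ b)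
    (ha : (a, j) ∈ φ.dom) (hb : (b, j) ∈ φ.dom)
    (hR : ∀ r ∈ φ.dom, r ≤ (b, j) → ‖φ.toFun r‖ ≤ R) :
    ‖φ.toFun (b, j) - φ.toFun (a, j)‖ ≤ L * (b - a) := by
  rcases hab.lt_or_eq with hlt | rfl
  · have hpos : 0 < b - a := sub_pos.2 hlt
    have hslope : (b - a)⁻¹ • (φ.toFun (b, j) - φ.toFun (a, j)) ∈ Metric.closedBall 0 L := by
      refine hφ.inv_smul_sub_mem hlt ha hb (convex_closedBall 0 L) Metric.isClosed_closedBall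
        fun t ht hC v hv => mem_closedBall_zero_iff.2 (hL _ hC (hR _ ?_ ⟨ht.2.le, le_rfl⟩) v hv)
      exact HybridArc.Icc_subset_interval ha hb (Set.Ioo_subset_Icc_self ht)
    rwa [mem_closedBall_zero_iff, norm_smul, norm_inv, Real.norm_of_nonneg hpos.le,
      inv_mul_le_iff₀ hpos, mul_comm] at hslope
  · simp only [sub_self, norm_zero, mul_zero, le_refl]

/-- Flows cannot leave the ball of radius `R` discontinuously, and a jump from that ball has length
controlled by the bound `L` on the jump map. -/
theorem norm_le_max_of_forall_lt (hφ : H.IsSolution φ) {R L : ℝ}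
    (hL : ∀ x ∈ H.D, ‖x‖ ≤ R → ∀ v ∈ H.G x, ‖v‖ ≤ L) (hp : p ∈ φ.dom) (hinit : ‖φ.init‖ ≤ R)
    (hR : ∀ r ∈ φ.dom, r < p → ‖φ.toFun r‖ ≤ R) : ‖φ.toFun p‖ ≤ max R L := by
  rcases φ.isHybridTimeDomain.eq_zero_or_flow_or_jump hp with rfl | ⟨s, hs, hsE⟩ | ⟨i, hi, hiE⟩
  · exact hinit.trans (le_max_left _ _)
  · have hmem : φ.toFun p ∈ Metric.closedBall 0 R := by
      refine closure_minimal ?_ Metric.isClosed_closedBall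
        (HybridArc.toFun_mem_closure_image_Ioo hsE hp hs (Set.right_mem_Icc.2 hs.le))
      rintro _ ⟨t, ht, rfl⟩
      exact mem_closedBall_zero_iff.2
        (hR _ (HybridArc.Icc_subset_interval hsE hp (Set.Ioo_subset_Icc_self ht))
          (Prod.lt_iff.2 (Or.inl ⟨ht.2, le_rfl⟩)))
    exact (mem_closedBall_zero_iff.1 hmem).trans (le_max_left _ _)
  · obtain ⟨t, j⟩ := p
    obtain rfl : j = i + 1 := hi
    obtain ⟨hD, hG⟩ := hφ.jump t i hiE hp
    exact (hL _ hD (hR _ hiE (Prod.lt_iff.2 (Or.inr ⟨le_rfl, i.lt_succ_self⟩))) _ hG).trans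
      (le_max_right _ _)

end Bounds

end IsSolution

end HybridSystem

namespace HybridArc

section ApproximatingTimes

variable {n : ℕ} {ι : Type*} {U : Ultrafilter ι} {φ : ι → HybridArc n} {R R' : ℝ}
  {q q' : ι → ℝ × ℕ} {p p' : ℝ × ℕ}

/-- The times `q k` of the arcs `φ k` converge to `p` along the ultrafilter `U`, and `R` bounds
the arcs up to these times. Graphical limits are computed along such times only, so that no
point of the limit stems from arcs that escape to infinity in bounded time. -/
structure ApproxTime (U : Ultrafilter ι) (φ : ι → HybridArc n) (R : ℝ) (q : ι → ℝ × ℕ)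
    (p : ℝ × ℕ) : Prop where
  mem_dom : ∀ᶠ k in (U : Filter ι), q k ∈ (φ k).dom
  norm_le : ∀ᶠ k in (U : Filter ι), ∀ r ∈ (φ k).dom, r ≤ q k → ‖(φ k).toFun r‖ ≤ R
  tendsto : Tendsto q U (𝓝 p)

/-- The domain of the graphical limit of the arcs `φ k` along the ultrafilter `U`. -/
def limitDomain (U : Ultrafilter ι) (φ : ι → HybridArc n) : Set (ℝ × ℕ) :=
  {p | ∃ R q, ApproxTime U φ R q p}

/-- Over each bounded horizon, the arcs `φ k` are eventually bounded uniformly in `k`. -/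
def LocallyEventuallyBounded (U : Ultrafilter ι) (φ : ι → HybridArc n) : Prop :=
  ∀ T : ℝ, ∃ R, ∀ᶠ k in (U : Filter ι), ∀ q ∈ (φ k).dom, q.1 + (q.2 : ℝ) ≤ T →
    ‖(φ k).toFun q‖ ≤ R

namespace ApproxTime

theorem fst_tendsto (h : ApproxTime U φ R q p) : Tendsto (fun k => (q k).1) U (𝓝 p.1) :=
  (continuous_fst.tendsto p).comp h.tendsto

theorem snd_tendsto (h : ApproxTime U φ R q p) : Tendsto (fun k => (q k).2) U (𝓝 p.2) :=
  (continuous_snd.tendsto p).comp h.tendsto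

theorem snd_eq (h : ApproxTime U φ R q p) : ∀ᶠ k in (U : Filter ι), (q k).2 = p.2 :=
  tendsto_pure.1 (nhds_discrete ℕ ▸ h.snd_tendsto)

theorem of_le (h : ApproxTime U φ R q p) (hmem : ∀ᶠ k in (U : Filter ι), q' k ∈ (φ k).dom)
    (hle : ∀ᶠ k in (U : Filter ι), q' k ≤ q k) (hq' : Tendsto q' U (𝓝 p')) :
    ApproxTime U φ R q' p' where
  mem_dom := hmem
  norm_le := by
    filter_upwards [h.norm_le, hle] with k hR hk r hr hrq using hR r hr (hrq.trans hk)
  tendsto := hq'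

theorem mono_bound (h : ApproxTime U φ R q p) (hRR' : R ≤ R') : ApproxTime U φ R' q p where
  mem_dom := h.mem_dom
  norm_le := h.norm_le.mono fun _ hk r hr hrq => (hk r hr hrq).trans hRR'
  tendsto := h.tendsto

theorem inf (h : ApproxTime U φ R q p) (h' : ApproxTime U φ R' q' p')
    (hchain : ∀ k, IsChain (· ≤ ·) (φ k).dom) :
    ApproxTime U φ R (fun k => q k ⊓ q' k) (p ⊓ p') := by
  have hlim : Tendsto (fun k => q k ⊓ q' k) U (𝓝 (p ⊓ p')) :=
    (h.fst_tendsto.inf_nhds h'.fst_tendsto).prodMk_nhds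
      (h.snd_tendsto.inf_nhds h'.snd_tendsto)
  refine h.of_le ?_ (Eventually.of_forall fun k => inf_le_left) hlim
  filter_upwards [h.mem_dom, h'.mem_dom] with k hk hk'
  rcases (hchain k).total hk hk' with hle | hle
  · rwa [inf_eq_left.2 hle]
  · rwa [inf_eq_right.2 hle]

theorem exists_of_mem_limitDomain (h : ApproxTime U φ R q p)
    (hchain : ∀ k, IsChain (· ≤ ·) (φ k).dom) (hp' : p' ∈ limitDomain U φ) (hle : p' ≤ p) :
    ∃ r, ApproxTime U φ R r p' := by
  obtain ⟨R', q', h'⟩ := hp'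
  exact ⟨_, inf_eq_right.2 hle ▸ h.inf h' hchain⟩

theorem zero (hinit : ∀ᶠ k in (U : Filter ι), ‖(φ k).init‖ ≤ R) :
    ApproxTime U φ R (fun _ => 0) 0 where
  mem_dom := Eventually.of_forall fun k => (φ k).zero_mem_dom
  norm_le := by
    filter_upwards [hinit] with k hk r hr hr0
    rwa [hr0.antisymm ((φ k).isHybridTimeDomain.zero_le hr)]
  tendsto := tendsto_const_nhds

theorem const_of_mem_Ioo {a b s : ℝ} {j : ℕ} (ha : ApproxTime U φ R q (a, j))
    (hb : ApproxTime U φ R' q' (b, j)) (hs : s ∈ Set.Ioo a b) :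
    ApproxTime U φ R' (fun _ => (s, j)) (s, j) := by
  have hle : ∀ᶠ k in (U : Filter ι), (s, j) ≤ q' k := by
    filter_upwards [hb.snd_eq, hb.fst_tendsto.eventually_const_le hs.2] with k hj hsk
    exact ⟨hsk, hj.ge⟩
  refine hb.of_le ?_ hle tendsto_const_nhds
  filter_upwards [ha.snd_eq, ha.mem_dom, ha.fst_tendsto.eventually_le_const hs.1, hb.snd_eq,
    hb.mem_dom, hle] with k haj hak has hbj hbk hbs
  have hak' : ((q k).1, j) ∈ (φ k).dom := (Prod.ext rfl haj.symm : ((q k).1, j) = q k) ▸ hak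
  have hbk' : ((q' k).1, j) ∈ (φ k).dom := (Prod.ext rfl hbj.symm : ((q' k).1, j) = q' k) ▸ hbk
  exact (φ k).isHybridTimeDomain.mem_of_mem_Icc hak' hbk' ⟨has, hbs.1⟩

theorem exists_tendsto_isJumpTimes (h : ApproxTime U φ R q p) :
    ∃ (t : ι → ℕ → ℝ) (τ : ℕ → ℝ),
      (∀ᶠ k in (U : Filter ι), IsJumpTimes (φ k).dom (q k) (t k)) ∧
      ∀ i, Tendsto (fun k => t k i) U (𝓝 (τ i)) := by
  obtain ⟨t, ht⟩ :=
    (h.mem_dom.mono fun k hk => (φ k).isHybridTimeDomain.exists_isJumpTimes hk).choice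
  have hlim : ∀ i, ∃ τ, Tendsto (fun k => t k i) U (𝓝 τ) := by
    intro i
    have hmem : ∀ᶠ k in (U : Filter ι), t k i ∈ Set.Icc 0 (p.1 + 1) := by
      filter_upwards [ht, h.fst_tendsto.eventually_le_const (lt_add_one p.1)] with k hk hqk
      exact ⟨hk.nonneg i, (hk.le_fst i).trans hqk⟩
    obtain ⟨τ, -, hτ⟩ := exists_tendsto_of_eventually_mem isCompact_Icc hmem
    exact ⟨τ, hτ⟩
  choose τ hτ using hlim
  exact ⟨t, τ, ht, hτ⟩

theorem mem_limitDomain_of_isJumpTimes (h : ApproxTime U φ R q p) {t : ι → ℕ → ℝ} {τ : ℕ → ℝ}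
    (ht : ∀ᶠ k in (U : Filter ι), IsJumpTimes (φ k).dom (q k) (t k))
    (hτ : ∀ i, Tendsto (fun k => t k i) U (𝓝 (τ i))) {r : ℝ × ℕ} (hrp : r.2 ≤ p.2)
    (hr : r.1 ∈ Set.Icc (τ r.2) (τ (r.2 + 1))) : r ∈ limitDomain U φ := by
  have hmem : ∀ᶠ k in (U : Filter ι),
      (max (t k r.2) (min r.1 (t k (r.2 + 1))), r.2) ∈ (φ k).dom ∧
      (max (t k r.2) (min r.1 (t k (r.2 + 1))), r.2) ≤ q k := by
    filter_upwards [ht, h.snd_eq] with k hk hqk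
    exact (hk.mem_iff _).2 ⟨hrp.trans hqk.ge, le_max_left _ _,
      max_le (hk.mono (Nat.le_succ _)) (min_le_right _ _)⟩
  have hlim : Tendsto (fun k => max (t k r.2) (min r.1 (t k (r.2 + 1)))) U (𝓝 r.1) := by
    simpa [hr.1, hr.2] using (hτ r.2).max ((tendsto_const_nhds (x := r.1)).min (hτ (r.2 + 1)))
  exact ⟨R, _, h.of_le (hmem.mono fun _ hk => hk.1) (hmem.mono fun _ hk => hk.2)
    (hlim.prodMk_nhds tendsto_const_nhds)⟩

theorem isJumpTimes_limitDomain (h : ApproxTime U φ R q p)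
    (hchain : ∀ k, IsChain (· ≤ ·) (φ k).dom) {t : ι → ℕ → ℝ} {τ : ℕ → ℝ}
    (ht : ∀ᶠ k in (U : Filter ι), IsJumpTimes (φ k).dom (q k) (t k))
    (hτ : ∀ i, Tendsto (fun k => t k i) U (𝓝 (τ i))) : IsJumpTimes (limitDomain U φ) p τ where
  zero := tendsto_nhds_unique (hτ 0)
    (tendsto_const_nhds.congr' (ht.mono fun _ hk => hk.zero.symm))
  mono i i' hii' := le_of_tendsto_of_tendsto (hτ i) (hτ i') (ht.mono fun _ hk => hk.mono hii')
  eq_fst i hi := by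
    refine tendsto_nhds_unique (hτ i) (h.fst_tendsto.congr' ?_)
    filter_upwards [ht, h.snd_eq] with k hk hqk using (hk.eq_fst i (hqk.symm ▸ hi)).symm
  mem_iff r := by
    refine ⟨fun ⟨hr, hrp⟩ => ?_, fun ⟨hrp, hr⟩ =>
      ⟨h.mem_limitDomain_of_isJumpTimes ht hτ hrp hr, ?_, hrp⟩⟩
    · obtain ⟨R', q', h'⟩ := hr
      have hinf := h.inf h' hchain
      rw [inf_eq_right.2 hrp] at hinf
      have hmem : ∀ᶠ k in (U : Filter ι), r.2 ≤ p.2 ∧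
          t k r.2 ≤ (q k ⊓ q' k).1 ∧ (q k ⊓ q' k).1 ≤ t k (r.2 + 1) := by
        filter_upwards [ht, hinf.mem_dom, hinf.snd_eq, h.snd_eq] with k hk hqk hrk hpk
        have := (hk.mem_iff _).1 ⟨hqk, inf_le_left⟩
        rwa [hrk, hpk] at this
      exact ⟨hrp.2, le_of_tendsto_of_tendsto (hτ _) hinf.fst_tendsto
        (hmem.mono fun _ hk => hk.2.1), le_of_tendsto_of_tendsto hinf.fst_tendsto (hτ _)
        (hmem.mono fun _ hk => hk.2.2)⟩
    · exact hr.2.trans (le_of_tendsto_of_tendsto (hτ _) h.fst_tendsto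
        (ht.mono fun _ hk => hk.le_fst _))

end ApproxTime

theorem isHybridTimeDomain_limitDomain (hchain : ∀ k, IsChain (· ≤ ·) (φ k).dom) :
    IsHybridTimeDomain (limitDomain U φ) :=
  isHybridTimeDomain_of_isJumpTimes fun _ ⟨_, _, h⟩ =>
    let ⟨_, τ, ht, hτ⟩ := h.exists_tendsto_isJumpTimes
    ⟨τ, h.isJumpTimes_limitDomain hchain ht hτ⟩

theorem exists_approxTime_const {t : ℝ} {j : ℕ}
    (ht : t ∈ interior {s : ℝ | (s, j) ∈ limitDomain U φ}) :
    ∃ R, ∀ᶠ s in 𝓝 t, ApproxTime U φ R (fun _ => (s, j)) (s, j) := by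
  obtain ⟨l, u, htlu, hlu⟩ := mem_nhds_iff_exists_Ioo_subset.1 (mem_interior_iff_mem_nhds.1 ht)
  obtain ⟨a, hla, hat⟩ := exists_between htlu.1
  obtain ⟨b, htb, hbu⟩ := exists_between htlu.2
  obtain ⟨_, qa, ha⟩ := hlu ⟨hla, hat.trans htlu.2⟩
  obtain ⟨R, qb, hb⟩ := hlu ⟨htlu.1.trans htb, hbu⟩
  exact ⟨R, mem_of_superset (Ioo_mem_nhds hat htb) fun s hs => ha.const_of_mem_Ioo hb hs⟩

theorem exists_approxTime_jump (hchain : ∀ k, IsChain (· ≤ ·) (φ k).dom) {t : ℝ} {j : ℕ}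
    (h : (t, j) ∈ limitDomain U φ) (h' : (t, j + 1) ∈ limitDomain U φ) :
    ∃ (R : ℝ) (s : ι → ℝ), ApproxTime U φ R (fun k => (s k, j)) (t, j) ∧
      ApproxTime U φ R (fun k => (s k, j + 1)) (t, j + 1) := by
  obtain ⟨_, qa, ha⟩ := h
  obtain ⟨R, qb, hb⟩ := h'
  obtain ⟨s, hs⟩ : ∃ s : ι → ℝ, ∀ᶠ k in (U : Filter ι), s k ∈ Set.Icc (qa k).1 (qb k).1 ∧
      (s k, j) ∈ (φ k).dom ∧ (s k, j + 1) ∈ (φ k).dom := by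
    refine Eventually.choice (r := fun k s => s ∈ Set.Icc (qa k).1 (qb k).1 ∧
      (s, j) ∈ (φ k).dom ∧ (s, j + 1) ∈ (φ k).dom) ?_
    filter_upwards [ha.mem_dom, hb.mem_dom, ha.snd_eq, hb.snd_eq] with k hak hbk haj hbj
    have hlt : (qa k).2 < (qb k).2 := by simp only [haj, hbj, Nat.lt_succ_self]
    have hle := ((hchain k).total hak hbk).resolve_right fun hle => hlt.not_ge hle.2
    simpa only [haj] using (φ k).isHybridTimeDomain.exists_jump hbk hak hle hlt
  have hlim : Tendsto s U (𝓝 t) := tendsto_of_tendsto_of_tendsto_of_le_of_le'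
    ha.fst_tendsto hb.fst_tendsto (hs.mono fun _ hk => hk.1.1) (hs.mono fun _ hk => hk.1.2)
  have hle : ∀ᶠ k in (U : Filter ι), (s k, j + 1) ≤ qb k := by
    filter_upwards [hs, hb.snd_eq] with k hk hbj using ⟨hk.1.2, hbj.ge⟩
  exact ⟨R, s,
    hb.of_le (hs.mono fun _ hk => hk.2.1)
      (hle.mono fun _ hk => (Prod.mk_le_mk.2 ⟨le_rfl, Nat.le_succ j⟩).trans hk)
      (hlim.prodMk_nhds tendsto_const_nhds),
    hb.of_le (hs.mono fun _ hk => hk.2.2) hle (hlim.prodMk_nhds tendsto_const_nhds)⟩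

theorem exists_approxTime_of_length_le {T : ℝ}
    (hq : ∀ᶠ k in (U : Filter ι), q k ∈ (φ k).dom ∧ (q k).1 + ((q k).2 : ℝ) ≤ T)
    (hR : ∀ᶠ k in (U : Filter ι), ∀ r ∈ (φ k).dom, r ≤ q k → ‖(φ k).toFun r‖ ≤ R) :
    ∃ p, ApproxTime U φ R q p := by
  have hIcc : ∀ᶠ k in (U : Filter ι), q k ∈ Set.Icc (0 : ℝ × ℕ) (T, ⌈T⌉₊) := by
    filter_upwards [hq] with k ⟨hqk, hT⟩
    have hnonneg := (φ k).isHybridTimeDomain.zero_le hqk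
    exact ⟨hnonneg, (le_add_of_nonneg_right (Nat.cast_nonneg _)).trans hT,
      Nat.cast_le.1 (((le_add_of_nonneg_left hnonneg.1).trans hT).trans (Nat.le_ceil T))⟩
  obtain ⟨p, -, hp⟩ := exists_tendsto_of_eventually_mem isCompact_Icc hIcc
  exact ⟨p, hq.mono fun _ hk => hk.1, hR, hp⟩

namespace LocallyEventuallyBounded

theorem exists_approxTime (hφ : LocallyEventuallyBounded U φ) {T : ℝ}
    (hq : ∀ᶠ k in (U : Filter ι), q k ∈ (φ k).dom ∧ (q k).1 + ((q k).2 : ℝ) ≤ T) :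
    ∃ R p, ApproxTime U φ R q p := by
  obtain ⟨R, hR⟩ := hφ T
  refine ⟨R, exists_approxTime_of_length_le hq ?_⟩
  filter_upwards [hq, hR] with k hk hRk r hr hrq
  exact hRk r hr ((strictMono_fst_add_snd.monotone hrq).trans hk.2)

theorem exists_norm_init_le (hφ : LocallyEventuallyBounded U φ) :
    ∃ R, ∀ᶠ k in (U : Filter ι), ‖(φ k).init‖ ≤ R := by
  obtain ⟨R, hR⟩ := hφ 0
  exact ⟨R, hR.mono fun k hk => hk 0 (φ k).zero_mem_dom (by simp)⟩

end LocallyEventuallyBounded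

end ApproximatingTimes

end HybridArc

section GraphicalLimit

open HybridArc

variable {n : ℕ} {ι : Type*} {U : Ultrafilter ι} {φ : ι → HybridArc n} {ψ : HybridArc n}
  {H : HybridSystem n}

/-- The arc `ψ` is the graphical limit of the arcs `φ k` along the ultrafilter `U`. -/
structure IsGraphicalLimit (U : Ultrafilter ι) (φ : ι → HybridArc n) (ψ : HybridArc n) :
    Prop where
  dom_eq : ψ.dom = limitDomain U φ
  tendsto : ∀ R q p, ApproxTime U φ R q p →
    Tendsto (fun k => (φ k).toFun (q k)) U (𝓝 (ψ.toFun p))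

namespace HybridArc.ApproxTime

variable {R R' L : ℝ} {q q' : ι → ℝ × ℕ} {p p' : ℝ × ℕ}

theorem eventually_norm_sub_le (h : ApproxTime U φ R q p) (h' : ApproxTime U φ R q' p')
    (hpp' : p.2 = p'.2) (hsol : ∀ k, H.IsSolution (φ k))
    (hL : ∀ x ∈ H.C, ‖x‖ ≤ R → ∀ v ∈ H.F x, ‖v‖ ≤ L) :
    ∀ᶠ k in (U : Filter ι),
      ‖(φ k).toFun (q k) - (φ k).toFun (q' k)‖ ≤ L * |(q k).1 - (q' k).1| := by
  filter_upwards [h.snd_eq, h'.snd_eq, h.mem_dom, h'.mem_dom, h.norm_le, h'.norm_le]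
    with k hj hj' hk hk' hR hR'
  have hjj' : (q k).2 = (q' k).2 := hj.trans (hpp'.trans hj'.symm)
  generalize q k = r, q' k = r' at *
  obtain ⟨s, j⟩ := r
  obtain ⟨s', j'⟩ := r'
  obtain rfl : j = j' := hjj'
  rcases le_total s' s with hle | hle
  · rw [abs_of_nonneg (sub_nonneg.2 hle)]
    exact (hsol k).norm_sub_le hL hle hk' hk hR
  · rw [abs_sub_comm, abs_of_nonneg (sub_nonneg.2 hle), norm_sub_rev]
    exact (hsol k).norm_sub_le hL hle hk hk' hR'

theorem tendsto_sub_zero (hH : H.BasicConditions) (hsol : ∀ k, H.IsSolution (φ k))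
    (h : ApproxTime U φ R q p) (h' : ApproxTime U φ R' q' p) :
    Tendsto (fun k => (φ k).toFun (q k) - (φ k).toFun (q' k)) U (𝓝 0) := by
  obtain ⟨L, hL⟩ := hH.locallyBounded_F.exists_norm_le hH.isClosed_C (max R R')
  refine squeeze_zero_norm' ((h.mono_bound (le_max_left _ _)).eventually_norm_sub_le
    (h'.mono_bound (le_max_right _ _)) rfl hsol hL) ?_
  simpa using (h.fst_tendsto.sub h'.fst_tendsto).abs.const_mul L

end HybridArc.ApproxTime

theorem HybridSystem.IsSolution.inv_smul_sub_mem_cthickening {χ : HybridArc n}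
    (hχ : H.IsSolution χ) {x : EuclideanSpace ℝ (Fin n)} (hconv : Convex ℝ (H.F x))
    {ε ρ R L a b : ℝ} {j : ℕ}
    (hF : ∀ ⦃y⦄, dist y x < ρ → y ∈ H.C → H.F y ⊆ Metric.thickening ε (H.F x))
    (hL : ∀ y ∈ H.C, ‖y‖ ≤ R → ∀ v ∈ H.F y, ‖v‖ ≤ L) (hab : a < b) (ha : (a, j) ∈ χ.dom)
    (hb : (b, j) ∈ χ.dom) (hR : ∀ r ∈ χ.dom, r ≤ (b, j) → ‖χ.toFun r‖ ≤ R)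
    (hLab : |L| * (b - a) < ρ / 2) (hax : dist (χ.toFun (a, j)) x < ρ / 2) :
    (b - a)⁻¹ • (χ.toFun (b, j) - χ.toFun (a, j)) ∈ Metric.cthickening ε (H.F x) := by
  refine hχ.inv_smul_sub_mem hab ha hb (hconv.cthickening ε) Metric.isClosed_cthickening
    fun s hs hsC => (hF ?_ hsC).trans (Metric.thickening_subset_cthickening _ _)
  have hsχ := χ.isHybridTimeDomain.mem_of_mem_Icc ha hb ⟨hs.1.le, hs.2.le⟩
  have hsb : (s, j) ≤ (b, j) := ⟨hs.2.le, le_rfl⟩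
  calc dist (χ.toFun (s, j)) x
      ≤ ‖χ.toFun (s, j) - χ.toFun (a, j)‖ + dist (χ.toFun (a, j)) x :=
        dist_eq_norm (χ.toFun (s, j)) _ ▸ dist_triangle _ _ _
    _ ≤ L * (s - a) + dist (χ.toFun (a, j)) x := by
        gcongr
        exact hχ.norm_sub_le hL hs.1.le ha hsχ fun r hr hrs => hR r hr (hrs.trans hsb)
    _ ≤ |L| * (b - a) + dist (χ.toFun (a, j)) x := by
        gcongr
        exacts [sub_nonneg.2 hs.1.le, le_abs_self L, hs.2.le]
    _ < ρ := by linarith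

theorem exists_tendsto_approxTime (hH : H.BasicConditions) (hsol : ∀ k, H.IsSolution (φ k))
    (p : ℝ × ℕ) :
    ∃ x, ∀ R q, ApproxTime U φ R q p → Tendsto (fun k => (φ k).toFun (q k)) U (𝓝 x) := by
  by_cases hp : p ∈ limitDomain U φ
  · obtain ⟨R, q, h⟩ := hp
    have hmem : ∀ᶠ k in (U : Filter ι), (φ k).toFun (q k) ∈ Metric.closedBall 0 R := by
      filter_upwards [h.mem_dom, h.norm_le] with k hk hR
      simpa using hR _ hk le_rfl
    obtain ⟨x, -, hx⟩ := exists_tendsto_of_eventually_mem (isCompact_closedBall _ _) hmem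
    exact ⟨x, fun R' q' h' => by simpa using (h'.tendsto_sub_zero hH hsol h).add hx⟩
  · exact ⟨0, fun R q h => absurd ⟨R, q, h⟩ hp⟩

theorem exists_lipschitzOnWith_limitDomain (hH : H.BasicConditions)
    (hsol : ∀ k, H.IsSolution (φ k)) (hchain : ∀ k, IsChain (· ≤ ·) (φ k).dom)
    {f : ℝ × ℕ → EuclideanSpace ℝ (Fin n)}
    (hf : ∀ R q p, ApproxTime U φ R q p → Tendsto (fun k => (φ k).toFun (q k)) U (𝓝 (f p)))
    {p : ℝ × ℕ} (hp : p ∈ limitDomain U φ) :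
    ∃ L, LipschitzOnWith L (fun s => f (s, p.2)) {s | (s, p.2) ∈ limitDomain U φ ∧ s ≤ p.1} := by
  obtain ⟨R, q, h⟩ := hp
  obtain ⟨L, hL⟩ := hH.locallyBounded_F.exists_norm_le hH.isClosed_C R
  refine ⟨L.toNNReal, LipschitzOnWith.of_dist_le_mul fun s hs s' hs' => ?_⟩
  obtain ⟨r, hr⟩ := h.exists_of_mem_limitDomain hchain hs.1 ⟨hs.2, le_rfl⟩
  obtain ⟨r', hr'⟩ := h.exists_of_mem_limitDomain hchain hs'.1 ⟨hs'.2, le_rfl⟩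
  rw [dist_eq_norm, Real.dist_eq]
  refine (le_of_tendsto_of_tendsto ((hf _ _ _ hr).sub (hf _ _ _ hr')).norm
    ((hr.fst_tendsto.sub hr'.fst_tendsto).abs.const_mul L)
    (hr.eventually_norm_sub_le hr' rfl hsol hL)).trans ?_
  gcongr
  exact L.le_coe_toNNReal

theorem exists_isGraphicalLimit (hH : H.BasicConditions) (hsol : ∀ k, H.IsSolution (φ k))
    (hchain : ∀ k, IsChain (· ≤ ·) (φ k).dom) {R : ℝ}
    (hinit : ∀ᶠ k in (U : Filter ι), ‖(φ k).init‖ ≤ R) : ∃ ψ, IsGraphicalLimit U φ ψ := by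
  choose f hf using exists_tendsto_approxTime (U := U) hH hsol
  have hdom := isHybridTimeDomain_limitDomain (U := U) hchain
  refine ⟨⟨limitDomain U φ, f, ⟨0, R, _, ApproxTime.zero hinit⟩, hdom,
    fun j a b ha hb => ?_⟩, rfl, fun R q p => hf p R q⟩
  wlog hab : a ≤ b generalizing a b
  · exact (this b a hb ha (le_of_not_ge hab)).symm
  obtain ⟨L, hL⟩ := exists_lipschitzOnWith_limitDomain hH hsol hchain (fun R q p => hf p R q) hb
  refine (hL.mono fun s hs => ?_).absolutelyContinuousOnInterval
  rw [Set.uIcc_of_le hab] at hs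
  exact ⟨hdom.mem_of_mem_Icc ha hb hs, hs.2⟩

namespace IsGraphicalLimit

theorem tendsto_init (hψ : IsGraphicalLimit U φ ψ) {R : ℝ}
    (hinit : ∀ᶠ k in (U : Filter ι), ‖(φ k).init‖ ≤ R) :
    Tendsto (fun k => (φ k).init) U (𝓝 ψ.init) :=
  hψ.tendsto _ _ _ (ApproxTime.zero hinit)

theorem exists_eventually_approxTime (hψ : IsGraphicalLimit U φ ψ) {t : ℝ} {j : ℕ}
    (ht : t ∈ interior (ψ.interval j)) :
    ∃ R, ∀ᶠ s in 𝓝 t, ApproxTime U φ R (fun _ => (s, j)) (s, j) :=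
  exists_approxTime_const (by rwa [HybridArc.interval, hψ.dom_eq] at ht)

theorem flow_mem (hψ : IsGraphicalLimit U φ ψ) (hC : IsClosed H.C)
    (hsol : ∀ k, H.IsSolution (φ k)) {t : ℝ} {j : ℕ} (ht : t ∈ interior (ψ.interval j)) :
    ψ.toFun (t, j) ∈ H.C := by
  obtain ⟨R, hR⟩ := hψ.exists_eventually_approxTime ht
  obtain ⟨l, u, htlu, hlu⟩ := mem_nhds_iff_exists_Ioo_subset.1 hR
  obtain ⟨a, hla, hat⟩ := exists_between htlu.1
  obtain ⟨b, htb, hbu⟩ := exists_between htlu.2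
  refine hC.mem_of_tendsto (hψ.tendsto _ _ _ (hlu htlu)) ?_
  filter_upwards [(hlu ⟨hla, hat.trans htlu.2⟩).mem_dom, (hlu ⟨htlu.1.trans htb, hbu⟩).mem_dom]
    with k ha hb
  exact (hsol k).flow_mem j t ((φ k).Ioo_subset_interior_interval ha hb ⟨hat, htb⟩)

theorem eventually_inv_smul_sub_mem (hψ : IsGraphicalLimit U φ ψ) (hH : H.BasicConditions)
    (hsol : ∀ k, H.IsSolution (φ k)) {t : ℝ} {j : ℕ} (ht : t ∈ interior (ψ.interval j))
    {ε : ℝ} (hε : 0 < ε) :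
    ∀ᶠ h in 𝓝[>] 0, h⁻¹ • (ψ.toFun (t + h, j) - ψ.toFun (t, j)) ∈
      Metric.cthickening ε (H.F (ψ.toFun (t, j))) := by
  have hC := hψ.flow_mem hH.isClosed_C hsol ht
  obtain ⟨R, hR⟩ := hψ.exists_eventually_approxTime ht
  obtain ⟨L, hL⟩ := hH.locallyBounded_F.exists_norm_le hH.isClosed_C R
  obtain ⟨ρ, hρ, hF⟩ := Metric.eventually_nhds_iff.1 (eventually_nhdsWithin_iff.1
    (hH.osc_F.eventually_subset_thickening hH.locallyBounded_F hC hε))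
  have hadd : Tendsto (fun h => t + h) (𝓝[>] 0) (𝓝 t) :=
    tendsto_nhdsWithin_of_tendsto_nhds ((continuous_const_add t).tendsto' 0 t (add_zero t))
  have hmul : Tendsto (fun h => |L| * h) (𝓝[>] 0) (𝓝 0) :=
    tendsto_nhdsWithin_of_tendsto_nhds ((continuous_const_mul |L|).tendsto' 0 0 (mul_zero _))
  filter_upwards [hadd.eventually hR, hmul.eventually_lt_const (half_pos hρ),
    self_mem_nhdsWithin] with h hth hLh hpos
  have hconv := hψ.tendsto _ _ _ hR.self_of_nhds
  refine Metric.isClosed_cthickening.mem_of_tendsto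
    (((hψ.tendsto _ _ _ hth).sub hconv).const_smul h⁻¹) ?_
  filter_upwards [hR.self_of_nhds.mem_dom, hth.mem_dom, hth.norm_le,
    Metric.tendsto_nhds.1 hconv _ (half_pos hρ)] with k hk hkh hRk hdist
  simpa using (hsol k).inv_smul_sub_mem_cthickening (hH.convex_F _ hC) hF hL
    (lt_add_of_pos_right t hpos) hk hkh hRk (by simpa using hLh) hdist

theorem flow_deriv (hψ : IsGraphicalLimit U φ ψ) (hH : H.BasicConditions)
    (hsol : ∀ k, H.IsSolution (φ k)) (j : ℕ) :
    ∀ᵐ t : ℝ, t ∈ interior (ψ.interval j) →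
      ∃ v ∈ H.F (ψ.toFun (t, j)), HasDerivAt (fun s => ψ.toFun (s, j)) v t := by
  filter_upwards [ψ.ae_differentiableAt j] with t hdiff ht
  have hderiv := (hdiff ht).hasDerivAt
  refine ⟨_, ?_, hderiv⟩
  rw [← (hH.osc_F.isClosed (hψ.flow_mem hH.isClosed_C hsol ht)).closure_eq,
    Metric.closure_eq_iInter_cthickening]
  exact Set.mem_iInter₂.2 fun ε hε => Metric.isClosed_cthickening.mem_of_tendsto
    hderiv.tendsto_slope_zero_right (hψ.eventually_inv_smul_sub_mem hH hsol ht hε)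

theorem jump (hψ : IsGraphicalLimit U φ ψ) (hH : H.BasicConditions)
    (hsol : ∀ k, H.IsSolution (φ k)) (hchain : ∀ k, IsChain (· ≤ ·) (φ k).dom) {t : ℝ} {j : ℕ}
    (h : (t, j) ∈ ψ.dom) (h' : (t, j + 1) ∈ ψ.dom) :
    ψ.toFun (t, j) ∈ H.D ∧ ψ.toFun (t, j + 1) ∈ H.G (ψ.toFun (t, j)) := by
  rw [hψ.dom_eq] at h h'
  obtain ⟨R, s, hs, hs'⟩ := exists_approxTime_jump hchain h h'
  have hjump : ∀ᶠ k in (U : Filter ι), (φ k).toFun (s k, j) ∈ H.D ∧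
      (φ k).toFun (s k, j + 1) ∈ H.G ((φ k).toFun (s k, j)) := by
    filter_upwards [hs.mem_dom, hs'.mem_dom] with k hk hk' using (hsol k).jump _ _ hk hk'
  have hD := hH.isClosed_D.mem_of_tendsto (hψ.tendsto _ _ _ hs) (hjump.mono fun _ hk => hk.1)
  exact ⟨hD, hH.osc_G.mem_of_tendsto hD (hjump.mono fun _ hk => hk.1)
    (hjump.mono fun _ hk => hk.2) (hψ.tendsto _ _ _ hs) (hψ.tendsto _ _ _ hs')⟩

theorem isSolution (hψ : IsGraphicalLimit U φ ψ) (hH : H.BasicConditions)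
    (hsol : ∀ k, H.IsSolution (φ k)) (hchain : ∀ k, IsChain (· ≤ ·) (φ k).dom) {R : ℝ}
    (hinit : ∀ᶠ k in (U : Filter ι), ‖(φ k).init‖ ≤ R) : H.IsSolution ψ where
  init_mem := (isClosed_closure.union hH.isClosed_D).mem_of_tendsto (hψ.tendsto_init hinit)
    (Eventually.of_forall fun k => (hsol k).init_mem)
  flow_mem _ _ ht := hψ.flow_mem hH.isClosed_C hsol ht
  flow_deriv := hψ.flow_deriv hH hsol
  jump _ _ h h' := hψ.jump hH hsol hchain h h'

end IsGraphicalLimit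

end GraphicalLimit

section CompactnessOfSolutions

open HybridArc

variable {n : ℕ} {ι : Type*} {U : Ultrafilter ι} {φ : ι → HybridArc n} {ψ : HybridArc n}
  {H : HybridSystem n} {p : ι → ℝ × ℕ} {X : Set (EuclideanSpace ℝ (Fin n))}

namespace IsGraphicalLimit

theorem mem_dom (hψ : IsGraphicalLimit U φ ψ) {R : ℝ} {q : ι → ℝ × ℕ} {P : ℝ × ℕ}
    (h : ApproxTime U φ R q P) : P ∈ ψ.dom :=
  hψ.dom_eq.symm ▸ ⟨R, q, h⟩

/-- The first times at which the norms reach `R` approximate a time at which the limit has norm at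
least `R`. -/
theorem eventually_norm_lt (hψ : IsGraphicalLimit U φ ψ) (hH : H.BasicConditions)
    (hsol : ∀ k, H.IsSolution (φ k)) {R₀ : ℝ}
    (hinit : ∀ᶠ k in (U : Filter ι), ‖(φ k).init‖ ≤ R₀) {B R : ℝ}
    (hB : ∀ P ∈ ψ.dom, ‖ψ.toFun P‖ ≤ B) (hBR : B < R) (T : ℝ) :
    ∀ᶠ k in (U : Filter ι), ∀ q ∈ (φ k).dom, q.1 + (q.2 : ℝ) ≤ T → ‖(φ k).toFun q‖ < R := by
  by_contra hcon
  obtain ⟨L, hL⟩ := hH.locallyBounded_G.exists_norm_le hH.isClosed_D R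
  obtain ⟨q, hq⟩ : ∃ q : ι → ℝ × ℕ, ∀ᶠ k in (U : Filter ι), q k ∈ (φ k).dom ∧
      (q k).1 + ((q k).2 : ℝ) ≤ T ∧ R ≤ ‖(φ k).toFun (q k)‖ ∧
      ∀ r ∈ (φ k).dom, r < q k → ‖(φ k).toFun r‖ < R := by
    refine Eventually.choice (r := fun k q => q ∈ (φ k).dom ∧ q.1 + (q.2 : ℝ) ≤ T ∧
      R ≤ ‖(φ k).toFun q‖ ∧ ∀ r ∈ (φ k).dom, r < q → ‖(φ k).toFun r‖ < R) ?_
    filter_upwards [Ultrafilter.eventually_not.2 hcon] with k hk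
    push Not at hk
    obtain ⟨p, hp, hpT, hpR⟩ := hk
    obtain ⟨q, hq, hqp, hqR, hlt⟩ := (φ k).exists_first_mem hp
      (isClosed_le continuous_const continuous_norm : IsClosed {x | R ≤ ‖x‖}) hpR
    exact ⟨q, hq, (strictMono_fst_add_snd.monotone hqp).trans hpT, hqR,
      fun r hr hrq => not_le.1 (hlt r hr hrq)⟩
  have hinit_lt : ∀ᶠ k in (U : Filter ι), ‖(φ k).init‖ < R :=
    (hψ.tendsto_init hinit).norm.eventually_lt_const ((hB 0 ψ.zero_mem_dom).trans_lt hBR)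
  have hbdd : ∀ᶠ k in (U : Filter ι), ∀ r ∈ (φ k).dom, r ≤ q k → ‖(φ k).toFun r‖ ≤ max R L := by
    filter_upwards [hq, hinit_lt] with k ⟨_, _, _, hlt⟩ hk r hr hrq
    exact (hsol k).norm_le_max_of_forall_lt hL hr hk.le
      fun r' hr' hr'r => (hlt r' hr' (hr'r.trans_le hrq)).le
  obtain ⟨P, hP⟩ := exists_approxTime_of_length_le (hq.mono fun _ hk => ⟨hk.1, hk.2.1⟩) hbdd
  have hRP : R ≤ ‖ψ.toFun P‖ :=
    ge_of_tendsto (hψ.tendsto _ _ _ hP).norm (hq.mono fun _ hk => hk.2.2.1)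
  exact ((hB P (hψ.mem_dom hP)).trans_lt hBR).not_ge hRP

end IsGraphicalLimit

theorem exists_norm_le_of_length_le (hH : H.BasicConditions)
    {K : Set (EuclideanSpace ℝ (Fin n))} (hK : IsCompact K)
    (hescape : ∀ φ, H.IsSolution φ → φ.init ∈ K → ¬ φ.IsComplete → φ.IsBounded) (T : ℝ) :
    ∃ R, ∀ φ, H.IsSolution φ → φ.init ∈ K → ∀ p ∈ φ.dom, p.1 + (p.2 : ℝ) ≤ T →
      ‖φ.toFun p‖ ≤ R := by
  by_contra! hcon
  choose φ hsol hinit p hp hpT hpk using fun k : ℕ => hcon k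
  obtain ⟨R, hR⟩ := hK.isBounded.exists_norm_le
  have htsol : ∀ k, H.IsSolution ((φ k).truncate (p k) (hp k)) := fun k => (hsol k).truncate (hp k)
  have hgreatest := fun k => isGreatest_truncate_dom (hp k)
  have hchain := fun k => ((φ k).truncate (p k) (hp k)).isHybridTimeDomain.isChain (hgreatest k)
  have htinit : ∀ᶠ k in (hyperfilter ℕ : Filter ℕ), ‖((φ k).truncate (p k) (hp k)).init‖ ≤ R :=
    Eventually.of_forall fun k => hR _ (hinit k)
  obtain ⟨ψ, hψ⟩ := exists_isGraphicalLimit hH htsol hchain htinit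
  have hψK : ψ.init ∈ K :=
    hK.isClosed.mem_of_tendsto (hψ.tendsto_init htinit) (Eventually.of_forall hinit)
  have hψT : ∀ P ∈ ψ.dom, P.1 + (P.2 : ℝ) ≤ T := by
    intro P hP
    obtain ⟨_, q, hq⟩ := hψ.dom_eq ▸ hP
    refine le_of_tendsto ((continuous_fst_add_snd.tendsto P).comp hq.tendsto) ?_
    filter_upwards [hq.mem_dom] with k hk
    exact (strictMono_fst_add_snd.monotone hk.2).trans (hpT k)
  have hψ_bdd : ψ.IsBounded := by
    refine hescape ψ (hψ.isSolution hH htsol hchain htinit) hψK fun hcomplete => ?_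
    obtain ⟨P, hP, hPT⟩ := hcomplete (T + 1)
    exact absurd (hψT P hP) (by linarith)
  obtain ⟨B, hB⟩ := hψ_bdd.exists_norm_le
  obtain ⟨k, hk_lt, hk⟩ := ((hψ.eventually_norm_lt hH htsol htinit
    (fun P hP => hB _ (Set.mem_image_of_mem _ hP)) (lt_add_one B) T).and
      (tendsto_natCast_hyperfilter.eventually_ge_atTop (B + 1))).exists
  exact (hk_lt _ (hgreatest k).1 (hpT k)).not_ge (hk.trans (hpk k).le)

theorem exists_isSolution_tendsto_of_length_le (hH : H.BasicConditions)
    (hsol : ∀ k, H.IsSolution (φ k)) (hp : ∀ k, IsGreatest (φ k).dom (p k))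
    (hbdd : LocallyEventuallyBounded U φ) {T : ℝ}
    (hlen : ∀ᶠ k in (U : Filter ι), (p k).1 + ((p k).2 : ℝ) ≤ T) :
    ∃ ψ, H.IsSolution ψ ∧ Tendsto (fun k => (φ k).init) U (𝓝 ψ.init) ∧
      ∃ P ∈ ψ.dom, Tendsto (fun k => (φ k).toFun (p k)) U (𝓝 (ψ.toFun P)) := by
  obtain ⟨_, hinit⟩ := hbdd.exists_norm_init_le
  have hchain := fun k => (φ k).isHybridTimeDomain.isChain (hp k)
  obtain ⟨ψ, hψ⟩ := exists_isGraphicalLimit hH hsol hchain hinit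
  obtain ⟨_, P, hP⟩ := hbdd.exists_approxTime (hlen.mono fun k hk => ⟨(hp k).1, hk⟩)
  exact ⟨ψ, hψ.isSolution hH hsol hchain hinit, hψ.tendsto_init hinit, P, hψ.mem_dom hP,
    hψ.tendsto _ _ _ hP⟩

theorem exists_isSolution_not_convergesTo (hH : H.BasicConditions)
    (hsol : ∀ k, H.IsSolution (φ k)) (hp : ∀ k, IsGreatest (φ k).dom (p k))
    (hbdd : LocallyEventuallyBounded U φ)
    (hlen : Tendsto (fun k => (p k).1 + ((p k).2 : ℝ)) U atTop) {δ T₀ : ℝ} (hδ : 0 < δ)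
    (hfar : ∀ᶠ k in (U : Filter ι), ∀ q ∈ (φ k).dom, T₀ ≤ q.1 + (q.2 : ℝ) →
      δ ≤ Metric.infDist ((φ k).toFun q) X) :
    ∃ ψ, H.IsSolution ψ ∧ Tendsto (fun k => (φ k).init) U (𝓝 ψ.init) ∧ ¬ ψ.ConvergesTo X := by
  obtain ⟨_, hinit⟩ := hbdd.exists_norm_init_le
  have hchain := fun k => (φ k).isHybridTimeDomain.isChain (hp k)
  obtain ⟨ψ, hψ⟩ := exists_isGraphicalLimit hH hsol hchain hinit
  refine ⟨ψ, hψ.isSolution hH hsol hchain hinit, hψ.tendsto_init hinit, fun hconv => ?_⟩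
  obtain ⟨T, hT⟩ := convergesTo_iff.1 hconv δ hδ
  set T' := max 0 (max T T₀)
  obtain ⟨q, hq⟩ : ∃ q : ι → ℝ × ℕ, ∀ᶠ k in (U : Filter ι), q k ∈ (φ k).dom ∧
      (q k).1 + ((q k).2 : ℝ) ∈ Set.Icc T' (T' + 1) := by
    refine Eventually.choice (r := fun k q => q ∈ (φ k).dom ∧
      q.1 + (q.2 : ℝ) ∈ Set.Icc T' (T' + 1)) ?_
    filter_upwards [hlen.eventually_ge_atTop T'] with k hk
    obtain ⟨q, hq, -, hqT⟩ :=
      (φ k).isHybridTimeDomain.exists_length_mem_Icc (hp k).1 (le_max_left _ _) hk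
    exact ⟨q, hq, hqT⟩
  obtain ⟨_, P, hP⟩ := hbdd.exists_approxTime (hq.mono fun _ hk => ⟨hk.1, hk.2.2⟩)
  have hPT : T' ≤ P.1 + (P.2 : ℝ) :=
    ge_of_tendsto ((continuous_fst_add_snd.tendsto P).comp hP.tendsto)
      (hq.mono fun _ hk => hk.2.1)
  have hPfar : δ ≤ Metric.infDist (ψ.toFun P) X := by
    refine ge_of_tendsto (((Metric.continuous_infDist_pt X).tendsto _).comp
      (hψ.tendsto _ _ _ hP)) ?_
    filter_upwards [hfar, hq] with k hk hqk
    exact hk _ hqk.1 (((le_max_right _ _).trans (le_max_right _ _)).trans hqk.2.1)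
  exact (hT P (hψ.mem_dom hP) (((le_max_left _ _).trans (le_max_right _ _)).trans hPT)).not_ge hPfar

end CompactnessOfSolutions

section DistanceToSet

variable {E : Type*} [SeminormedAddCommGroup E] {X : Set E}

theorem exists_norm_le_add_infDist (hX : Bornology.IsBounded X) (hne : X.Nonempty) :
    ∃ B, ∀ x, ‖x‖ ≤ B + Metric.infDist x X := by
  obtain ⟨B, hB⟩ := hX.exists_norm_le
  refine ⟨B, fun x => sub_le_iff_le_add'.1 ((Metric.le_infDist hne).2 fun y hy => ?_)⟩
  rw [dist_eq_norm]
  linarith [norm_le_norm_add_norm_sub' x y, hB y hy]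

theorem mem_of_tendsto_infDist {ι : Type*} {l : Filter ι} [l.NeBot] {u : ι → E} {x : E}
    (hX : IsClosed X) (hne : X.Nonempty) (hu : Tendsto u l (𝓝 x))
    (hdist : Tendsto (fun k => Metric.infDist (u k) X) l (𝓝 0)) : x ∈ X :=
  (hX.mem_iff_infDist_zero hne).2
    (tendsto_nhds_unique (((Metric.continuous_infDist_pt X).tendsto x).comp hu) hdist)

end DistanceToSet

namespace HybridSystem

open HybridArc

variable {n : ℕ} {H : HybridSystem n} {X Y : Set (EuclideanSpace ℝ (Fin n))}

section Stability

theorem StableRel.exists_infDist_lt (hstable : H.StableRel X Y) (hX : Bornology.IsBounded X)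
    (hne : X.Nonempty) {ε : ℝ} (hε : 0 < ε) :
    ∃ δ > 0, ∀ φ, H.IsSolution φ → φ.init ∈ Y → Metric.infDist φ.init X < δ →
      ∀ p ∈ φ.dom, Metric.infDist (φ.toFun p) X < ε := by
  obtain ⟨B, hB⟩ := exists_norm_le_add_infDist hX hne
  obtain ⟨δ, hδ, hδε⟩ := hstable ε hε (|B| + 1) (by positivity)
  simp only [Metric.mem_thickening_iff_infDist_lt hne, Set.mem_inter_iff, mem_ball_zero_iff]
    at hδε
  refine ⟨min δ 1, lt_min hδ one_pos, fun φ hφ hY hinit => ?_⟩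
  obtain ⟨hinit_δ, hinit_one⟩ := lt_min_iff.1 hinit
  exact hδε φ hφ hY ⟨hinit_δ, by linarith [hB φ.init, le_abs_self B]⟩

theorem StableRel.exists_le_infDist (hstable : H.StableRel X Y) (hX : Bornology.IsBounded X)
    (hne : X.Nonempty) {ε : ℝ} (hε : 0 < ε) :
    ∃ δ > 0, ∀ φ, H.IsSolution φ → (∀ r ∈ φ.dom, φ.toFun r ∈ Y) →
      ∀ p ∈ φ.dom, ε ≤ Metric.infDist (φ.toFun p) X →
        ∀ r ∈ φ.dom, r ≤ p → δ ≤ Metric.infDist (φ.toFun r) X := by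
  obtain ⟨δ, hδ, hδε⟩ := hstable.exists_infDist_lt hX hne hε
  refine ⟨min δ ε, lt_min hδ hε, fun φ hφ hY p hp hpε r hr hrp => ?_⟩
  rcases hrp.eq_or_lt with rfl | hlt
  · exact (min_le_right _ _).trans hpε
  · by_contra! hrδ
    refine (hδε _ (hφ.segment hr hp hlt) ?_ ?_ _ (isGreatest_segment_dom hr hp hrp).1).not_ge ?_
    · exact init_segment hr hp hrp ▸ hY r hr
    · exact init_segment hr hp hrp ▸ hrδ.trans_le (min_le_left _ _)
    · rwa [segment_toFun_sub]

end Stability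

section ExitingSolutions

variable {ι : Type*} {U : Ultrafilter ι} {φ : ι → HybridArc n} {p : ι → ℝ × ℕ} {R δ ε : ℝ}

theorem locallyEventuallyBounded_of_forall_lt (hH : H.BasicConditions)
    (hsol : ∀ k, H.IsSolution (φ k)) (hp : ∀ k, IsGreatest (φ k).dom (p k))
    (hinit : ∀ k, ‖(φ k).init‖ ≤ R)
    (hR : ∀ k, ∀ r ∈ (φ k).dom, r < p k → ‖(φ k).toFun r‖ ≤ R) :
    LocallyEventuallyBounded U φ := by
  obtain ⟨L, hL⟩ := hH.locallyBounded_G.exists_norm_le hH.isClosed_D R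
  exact fun _ => ⟨max R L, Eventually.of_forall fun k r hr _ =>
    (hsol k).norm_le_max_of_forall_lt hL hr (hinit k) fun r' hr' hr'r =>
      hR k r' hr' (hr'r.trans_le ((hp k).2 hr))⟩

/-- If the lengths of the solutions are bounded, their limit also reaches distance `ε`; otherwise
it stays at distance at least `δ` forever. -/
theorem exists_isSolution_exit_or_not_convergesTo (hH : H.BasicConditions)
    (hX : Bornology.IsBounded X) (hne : X.Nonempty) (hδ : 0 < δ) (hδε : δ < ε)
    (hsol : ∀ k, H.IsSolution (φ k)) (hp : ∀ k, IsGreatest (φ k).dom (p k))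
    (hinit : ∀ k, Metric.infDist (φ k).init X ≤ δ)
    (hend : ∀ k, ε ≤ Metric.infDist ((φ k).toFun (p k)) X)
    (hbetween : ∀ k, ∀ r ∈ (φ k).dom, r ≠ 0 → r ≠ p k →
      Metric.infDist ((φ k).toFun r) X ∈ Set.Ioo δ ε) :
    ∃ ψ, H.IsSolution ψ ∧ Tendsto (fun k => (φ k).init) U (𝓝 ψ.init) ∧
      ((∃ P ∈ ψ.dom, ε ≤ Metric.infDist (ψ.toFun P) X) ∨ ¬ ψ.ConvergesTo X) := by
  obtain ⟨B, hB⟩ := exists_norm_le_add_infDist hX hne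
  have hbdd : LocallyEventuallyBounded U φ := by
    refine locallyEventuallyBounded_of_forall_lt (R := B + ε) hH hsol hp
      (fun k => (hB _).trans (by linarith [hinit k])) fun k r hr hrp => (hB _).trans ?_
    gcongr
    rcases eq_or_ne r 0 with rfl | hr0
    · exact (hinit k).trans hδε.le
    · exact (hbetween k r hr hr0 hrp.ne).2.le
  rcases exists_eventually_le_or_tendsto_atTop U fun k => (p k).1 + ((p k).2 : ℝ) with
    ⟨T, hT⟩ | hlen
  · obtain ⟨ψ, hψ, hψinit, P, hP, hPlim⟩ :=
      exists_isSolution_tendsto_of_length_le hH hsol hp hbdd hT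
    exact ⟨ψ, hψ, hψinit, Or.inl ⟨P, hP, ge_of_tendsto
      (((Metric.continuous_infDist_pt X).tendsto _).comp hPlim) (Eventually.of_forall hend)⟩⟩
  · obtain ⟨ψ, hψ, hψinit, hψX⟩ := exists_isSolution_not_convergesTo (X := X) (T₀ := 1)
      hH hsol hp hbdd hlen hδ <| Eventually.of_forall fun k r hr hr1 => by
        have hr0 : r ≠ 0 := by
          rintro rfl
          norm_num at hr1
        rcases eq_or_ne r (p k) with rfl | hrp
        · exact hδε.le.trans (hend k)
        · exact (hbetween k r hr hr0 hrp).1.le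
    exact ⟨ψ, hψ, hψinit, Or.inr hψX⟩

end ExitingSolutions

section NestedSets

variable {Me Mi Mo : Set (EuclideanSpace ℝ (Fin n))}

theorem exists_infDist_lt_of_forall_infDist_lt (hH : H.BasicConditions) (hMi : IsClosed Mi)
    (hMi_ne : Mi.Nonempty) (hMo : Bornology.IsBounded Mo) (hMo_ne : Mo.Nonempty)
    (hMo_stable : H.StableRel Mo Mi) (hMo_attr : H.AttractiveRel Mo Mi) {ε : ℝ} (hε : 0 < ε) :
    ∃ δ > 0, ∃ ρ > 0, ∀ φ, H.IsSolution φ → Metric.infDist φ.init Mo < δ →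
      (∀ r ∈ φ.dom, Metric.infDist (φ.toFun r) Mi < ρ) →
        ∀ p ∈ φ.dom, Metric.infDist (φ.toFun p) Mo < ε := by
  obtain ⟨δa, hδa, hattr⟩ := hMo_attr
  obtain ⟨δs, hδs, hstable⟩ := hMo_stable.exists_infDist_lt hMo hMo_ne hε
  obtain ⟨δ, hδ, hδ_lt⟩ := exists_between (lt_min hδa (lt_min hδs hε))
  obtain ⟨hδδa, hδδs, hδε⟩ := by simpa only [lt_min_iff] using hδ_lt
  refine ⟨δ, hδ, ?_⟩
  by_contra! hcon
  choose φ hφ hinit hnear p hp hpε using fun k : ℕ => hcon (1 / ((k : ℝ) + 1)) (by positivity)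
  choose s hs q hq hsq hsδ hqε hbetween using fun k =>
    (φ k).exists_exit_interval (Metric.continuous_infDist_pt Mo) hδε (hinit k).le (hp k) (hpε k)
  obtain ⟨ψ, hψ, hψinit, hψ_exit⟩ :=
    exists_isSolution_exit_or_not_convergesTo (U := hyperfilter ℕ) (X := Mo)
      (φ := fun k => (φ k).segment (s k) (q k) (hs k) (hq k) (hsq k).le)
      (p := fun k => q k - s k) hH hMo hMo_ne hδ hδε
      (fun k => (hφ k).segment (hs k) (hq k) (hsq k))
      (fun k => isGreatest_segment_dom (hs k) (hq k) (hsq k).le)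
      (fun k => by rw [init_segment]; exact hsδ k)
      (fun k => by rw [segment_toFun_sub]; exact hqε k)
      (fun k r hr hr0 hrq =>
        have hr_mem := add_mem_Ioo_of_mem_segment_dom (hs k) (hq k) (hsq k).le hr hr0 hrq
        hbetween k _ (add_mem_of_mem_segment_dom (hs k) (hq k) (hsq k).le hr) hr_mem.1 hr_mem.2)
  simp only [init_segment] at hψinit
  have hψMi : ψ.init ∈ Mi := by
    refine mem_of_tendsto_infDist hMi hMi_ne hψinit (squeeze_zero
      (fun _ => Metric.infDist_nonneg) (fun k => (hnear k _ (hs k)).le) ?_)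
    exact tendsto_one_div_add_atTop_nhds_zero_nat.mono_left Nat.hyperfilter_le_atTop
  have hψδ : Metric.infDist ψ.init Mo ≤ δ := le_of_tendsto
    (((Metric.continuous_infDist_pt Mo).tendsto _).comp hψinit) (Eventually.of_forall hsδ)
  rcases hψ_exit with ⟨P, hP, hPε⟩ | hψ_not
  · exact (hstable ψ hψ hψMi (hψδ.trans_lt hδδs) P hP).not_ge hPε
  · exact hψ_not (hattr ψ hψ hψMi
      ((Metric.mem_thickening_iff_infDist_lt hMo_ne).2 (hψδ.trans_lt hδδa)))

theorem stableRel_of_nested (hH : H.BasicConditions) (hMi : IsClosed Mi)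
    (hMi_stable : H.StableRel Mi Me) (hMo : Bornology.IsBounded Mo) (hMo_ne : Mo.Nonempty)
    (hMo_sub : Mo ⊆ Mi) (hMo_stable : H.StableRel Mo Mi) (hMo_attr : H.AttractiveRel Mo Mi) :
    H.StableRel Mo Me := by
  intro ε hε Δ hΔ
  have hMi_ne := hMo_ne.mono hMo_sub
  obtain ⟨δo, hδo, ρ, hρ, hclose⟩ := exists_infDist_lt_of_forall_infDist_lt hH hMi hMi_ne hMo
    hMo_ne hMo_stable hMo_attr hε
  obtain ⟨δi, hδi, hnear⟩ := hMi_stable ρ hρ Δ hΔ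
  refine ⟨min δo δi, lt_min hδo hδi, fun φ hφ hinit_Me hinit => ?_⟩
  have hinit_Mo : Metric.infDist φ.init Mo < δo := (Metric.mem_thickening_iff_infDist_lt hMo_ne).1
    (Metric.thickening_mono (min_le_left _ _) Mo hinit.1)
  have hinit_Mi : φ.init ∈ Metric.thickening δi Mi := Metric.thickening_subset_of_subset _ hMo_sub
    (Metric.thickening_mono (min_le_right _ _) Mo hinit.1)
  simp only [Metric.mem_thickening_iff_infDist_lt hMi_ne] at hnear
  simp only [Metric.mem_thickening_iff_infDist_lt hMo_ne]
  exact hclose φ hφ hinit_Mo (hnear φ hφ hinit_Me ⟨hinit_Mi, hinit.2⟩)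

/-- If `φ` came back to distance `ε` of `Mo` at arbitrarily late times, then, by stability, longer
and longer late segments of `φ` would avoid a neighbourhood of `Mo`, and so would a limit of these
segments, which starts in `Mi`. -/
theorem convergesTo_of_nested (hH : H.BasicConditions) (hMi : IsClosed Mi)
    (hMi_ne : Mi.Nonempty) (hMo : Bornology.IsBounded Mo) (hMo_ne : Mo.Nonempty)
    (hMo_stable : H.StableRel Mo Me) {Q : Set (EuclideanSpace ℝ (Fin n))} (hQ : IsCompact Q)
    (hattr : ∀ ψ, H.IsSolution ψ → ψ.init ∈ Q ∩ Mi → ψ.ConvergesTo Mo)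
    {φ : HybridArc n} (hφ : H.IsSolution φ) (hφMe : ∀ r ∈ φ.dom, φ.toFun r ∈ Me)
    (hφQ : ∀ r ∈ φ.dom, φ.toFun r ∈ Q) (hφMi : φ.ConvergesTo Mi) : φ.ConvergesTo Mo := by
  by_contra hcon
  rw [convergesTo_iff] at hcon
  push Not at hcon
  obtain ⟨ε, hε, hlate⟩ := hcon
  obtain ⟨δ, hδ, hfar⟩ := hMo_stable.exists_le_infDist hMo hMo_ne hε
  obtain ⟨R, hR⟩ := hQ.isBounded.exists_norm_le
  choose p hp hplen hpε using fun k : ℕ => hlate (2 * k + 2)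
  choose s hs hsp hslen hsplen using fun k : ℕ =>
    φ.isHybridTimeDomain.exists_lt_le_length_sub (hp k) k.cast_nonneg (hplen k)
  obtain ⟨ψ, hψ, hψinit, hψ_not⟩ := exists_isSolution_not_convergesTo (X := Mo) (T₀ := 0)
    (φ := fun k => φ.segment (s k) (p k) (hs k) (hp k) (hsp k).le) hH
    (fun k => hφ.segment (hs k) (hp k) (hsp k))
    (fun k => isGreatest_segment_dom (hs k) (hp k) (hsp k).le)
    (fun _ => ⟨R, Eventually.of_forall fun k r hr _ => hR _ (hφQ (s k + r) hr.2.1)⟩)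
    (tendsto_atTop_mono hsplen tendsto_natCast_hyperfilter) hδ
    (Eventually.of_forall fun k r hr _ =>
      hfar φ hφ hφMe (p k) (hp k) (hpε k) (s k + r) hr.2.1 hr.2.2)
  simp only [init_segment] at hψinit
  have hs_tendsto : Tendsto s (hyperfilter ℕ : Filter ℕ)
      (comap (fun r : ℝ × ℕ => r.1 + (r.2 : ℝ)) atTop ⊓ 𝓟 φ.dom) :=
    tendsto_inf.2 ⟨tendsto_comap_iff.2 (tendsto_atTop_mono hslen tendsto_natCast_hyperfilter),
      tendsto_principal.2 (Eventually.of_forall hs)⟩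
  refine hψ_not (hattr ψ hψ ⟨?_, ?_⟩)
  · exact hQ.isClosed.mem_of_tendsto hψinit (Eventually.of_forall fun k => hφQ _ (hs k))
  · exact mem_of_tendsto_infDist hMi hMi_ne hψinit (hφMi.comp hs_tendsto)

theorem uniformlyAttractiveFrom_of_subset_basin (hH : H.BasicConditions)
    (hY : H.StronglyForwardInvariant Y) (hX : Bornology.IsBounded X) (hne : X.Nonempty)
    (hstable : H.StableRel X Y) {K : Set (EuclideanSpace ℝ (Fin n))} (hK : IsCompact K)
    (hK_sub : K ⊆ H.basin X ∩ Y) : H.UniformlyAttractiveFrom X K := by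
  intro ε hε
  by_contra! hcon
  obtain ⟨δ, hδ, hfar⟩ := hstable.exists_le_infDist hX hne hε
  choose φ hφ hinit p hp hplen hpε using fun k : ℕ => hcon k
  have hreach := exists_norm_le_of_length_le hH hK
    fun φ hφ hinit => ((hK_sub hinit).1 φ hφ rfl).1
  obtain ⟨ψ, hψ, hψinit, hψ_not⟩ := exists_isSolution_not_convergesTo (X := X) (T₀ := 0)
    (U := hyperfilter ℕ) (φ := fun k => (φ k).truncate (p k) (hp k)) hH
    (fun k => (hφ k).truncate (hp k)) (fun k => isGreatest_truncate_dom (hp k))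
    (fun T => (hreach T).imp fun R hR => Eventually.of_forall fun k r hr =>
      hR (φ k) (hφ k) (hinit k) r hr.1)
    (tendsto_atTop_mono hplen tendsto_natCast_hyperfilter) hδ
    (Eventually.of_forall fun k r hr _ => hfar (φ k) (hφ k)
      (hY _ (hφ k) (hK_sub (hinit k)).2) (p k) (hp k) (hpε k).le r hr.1 hr.2)
  have hψK : ψ.init ∈ K := hK.isClosed.mem_of_tendsto hψinit (Eventually.of_forall hinit)
  exact hψ_not ((hK_sub hψK).1 ψ hψ rfl).2

theorem isBounded_of_init_mem_basin (hH : H.BasicConditions) (hX : Bornology.IsBounded X)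
    (hne : X.Nonempty) {φ : HybridArc n} (hφ : H.IsSolution φ) (hinit : φ.init ∈ H.basin X) :
    φ.IsBounded := by
  obtain ⟨B, hB⟩ := exists_norm_le_add_infDist hX hne
  obtain ⟨T, hT⟩ := convergesTo_iff.1 (hinit φ hφ rfl).2 1 one_pos
  obtain ⟨R, hR⟩ := exists_norm_le_of_length_le hH (isCompact_singleton (x := φ.init))
    (fun ψ hψ hψinit => (hinit ψ hψ hψinit).1) T
  refine isBounded_iff_forall_norm_le.2 ⟨max R (B + 1), ?_⟩
  rintro _ ⟨p, hp, rfl⟩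
  rcases le_total (p.1 + (p.2 : ℝ)) T with hpT | hTp
  · exact (hR φ hφ rfl p hp hpT).trans (le_max_left _ _)
  · refine ((hB _).trans ?_).trans (le_max_right _ _)
    gcongr
    exact (hT p hp hTp).le

theorem attractiveRel_of_nested (hH : H.BasicConditions) (hMe : H.StronglyForwardInvariant Me)
    (hMi : IsClosed Mi) (hMo : Bornology.IsBounded Mo) (hMo_ne : Mo.Nonempty)
    (hMo_sub : Mo ⊆ Mi) (hMo_stable : H.StableRel Mo Me) (hMi_attr : H.AttractiveRel Mi Me)
    (hMo_attr : H.AttractiveRel Mo Mi) : H.AttractiveRel Mo Me := by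
  obtain ⟨δi, hδi, hMi_attr⟩ := hMi_attr
  obtain ⟨δo, hδo, hMo_attr⟩ := hMo_attr
  obtain ⟨δ, hδ, hstay⟩ := hMo_stable.exists_infDist_lt hMo hMo_ne (half_pos hδo)
  refine ⟨min δ δi, lt_min hδ hδi, fun φ hφ hinit_Me hinit => ?_⟩
  have hinit_δ : Metric.infDist φ.init Mo < δ := (Metric.mem_thickening_iff_infDist_lt hMo_ne).1
    (Metric.thickening_mono (min_le_left _ _) Mo hinit)
  have hinit_Mi : φ.init ∈ Metric.thickening δi Mi := Metric.thickening_subset_of_subset _ hMo_sub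
    (Metric.thickening_mono (min_le_right _ _) Mo hinit)
  refine convergesTo_of_nested hH hMi (hMo_ne.mono hMo_sub) hMo hMo_ne hMo_stable
    (Q := Metric.cthickening (δo / 2) Mo)
    (Metric.isCompact_of_isClosed_isBounded Metric.isClosed_cthickening hMo.cthickening)
    (fun ψ hψ hψinit => hMo_attr ψ hψ hψinit.2 ?_) hφ (hMe φ hφ hinit_Me) (fun r hr => ?_)
    (hMi_attr φ hφ hinit_Me hinit_Mi)
  · exact Metric.cthickening_subset_thickening' hδo (half_lt_self hδo) Mo hψinit.1
  · exact Metric.thickening_subset_cthickening _ _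
      ((Metric.mem_thickening_iff_infDist_lt hMo_ne).2 (hstay φ hφ hinit_Me hinit_δ r hr))

theorem uasRel_of_nested (hH : H.BasicConditions) (hMe : H.StronglyForwardInvariant Me)
    (hMi : IsClosed Mi) (hMi_stable : H.StableRel Mi Me) (hMo : Bornology.IsBounded Mo)
    (hMo_ne : Mo.Nonempty) (hMo_sub : Mo ⊆ Mi) (hMo_stable : H.StableRel Mo Mi)
    (hMi_attr : H.AttractiveRel Mi Me) (hMo_attr : H.AttractiveRel Mo Mi) : H.UASRel Mo Me :=
  have hstable := stableRel_of_nested hH hMi hMi_stable hMo hMo_ne hMo_sub hMo_stable hMo_attr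
  ⟨hstable,
    attractiveRel_of_nested hH hMe hMi hMo hMo_ne hMo_sub hstable hMi_attr hMo_attr,
    fun _ => uniformlyAttractiveFrom_of_subset_basin hH hMe hMo hMo_ne hstable⟩

theorem GloballyAttractiveRel.attractiveRel (h : H.GloballyAttractiveRel X Y) :
    H.AttractiveRel X Y :=
  ⟨1, one_pos, h 1 one_pos⟩

theorem GloballyAttractiveRel.convergesTo (h : H.GloballyAttractiveRel X Y) (hne : X.Nonempty)
    {φ : HybridArc n} (hφ : H.IsSolution φ) (hinit : φ.init ∈ Y) : φ.ConvergesTo X :=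
  h (Metric.infDist φ.init X + 1) (add_pos_of_nonneg_of_pos Metric.infDist_nonneg one_pos) φ hφ
    hinit ((Metric.mem_thickening_iff_infDist_lt hne).2 (lt_add_one _))

theorem mem_basin_of_forall_isBounded (hH : H.BasicConditions)
    (hMe : H.StronglyForwardInvariant Me) (hMi : IsClosed Mi) (hMi_ne : Mi.Nonempty)
    (hMo : Bornology.IsBounded Mo) (hMo_ne : Mo.Nonempty) (hMo_stable : H.StableRel Mo Me)
    (hMi_attr : H.GloballyAttractiveRel Mi Me) (hMo_attr : H.GloballyAttractiveRel Mo Mi)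
    {x : EuclideanSpace ℝ (Fin n)} (hx : x ∈ Me)
    (hbdd : ∀ φ, H.IsSolution φ → φ.init = x → φ.IsBounded) : x ∈ H.basin Mo := by
  rintro φ hφ rfl
  have hφ_bdd := hbdd φ hφ rfl
  exact ⟨fun _ => hφ_bdd, convergesTo_of_nested hH hMi hMi_ne hMo hMo_ne hMo_stable
    (Metric.isCompact_of_isClosed_isBounded isClosed_closure hφ_bdd.closure)
    (fun ψ hψ hψinit => hMo_attr.convergesTo hMo_ne hψ hψinit.2) hφ (hMe φ hφ hx)
    (fun r hr => subset_closure (Set.mem_image_of_mem _ hr)) (hMi_attr.convergesTo hMi_ne hφ hx)⟩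

end NestedSets

end HybridSystem

theorem lemma1_general {n : ℕ} (H : HybridSystem n) (hH : H.BasicConditions)
    (Me Mi Mo : Set (EuclideanSpace ℝ (Fin n)))
    (hMe_inv : H.StronglyForwardInvariant Me) (hMi : IsClosed Mi) (hMi_stable : H.StableRel Mi Me)
    (hMo : Bornology.IsBounded Mo) (hMo_ne : Mo.Nonempty) (hMo_sub : Mo ⊆ Mi)
    (hMo_stable : H.StableRel Mo Mi) :
    (H.GloballyAttractiveRel Mi Me → H.GloballyAttractiveRel Mo Mi →
      H.UASRel Mo Me ∧
      IsGreatest {S : Set (EuclideanSpace ℝ (Fin n)) |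
        S ⊆ Me ∧ ∀ φ, H.IsSolution φ → φ.init ∈ S → φ.IsBounded} (H.basin Mo ∩ Me) ∧
      (H.UGBRel Me → H.UGASRel Mo Me)) ∧
    (H.AttractiveRel Mi Me → H.AttractiveRel Mo Mi → H.UASRel Mo Me) := by
  have huas := HybridSystem.uasRel_of_nested hH hMe_inv hMi hMi_stable hMo hMo_ne hMo_sub
    hMo_stable
  refine ⟨fun hMi_attr hMo_attr => ?_, huas⟩
  have hMo_uas := huas hMi_attr.attractiveRel hMo_attr.attractiveRel
  have hbasin : ∀ x ∈ Me, (∀ φ, H.IsSolution φ → φ.init = x → φ.IsBounded) → x ∈ H.basin Mo :=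
    fun _ => HybridSystem.mem_basin_of_forall_isBounded hH hMe_inv hMi (hMo_ne.mono hMo_sub) hMo
      hMo_ne hMo_uas.1 hMi_attr hMo_attr
  refine ⟨hMo_uas, ⟨⟨Set.inter_subset_right, fun φ hφ hinit => ?_⟩, fun S hS x hx => ?_⟩,
    fun hUGB => ⟨hMo_uas, Set.inter_eq_right.2 fun x hx => hbasin x hx fun φ hφ hinit => ?_⟩⟩
  · exact HybridSystem.isBounded_of_init_mem_basin hH hMo hMo_ne hφ hinit.1
  · exact ⟨hbasin x (hS.1 hx) fun φ hφ hinit => hS.2 φ hφ (hinit ▸ hx), hS.1 hx⟩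
  · obtain ⟨Δ, -, hΔ⟩ := hUGB {x} isCompact_singleton (Set.singleton_subset_iff.2 hx)
    refine isBounded_iff_forall_norm_le.2 ⟨Δ, ?_⟩
    rintro _ ⟨p, hp, rfl⟩
    exact (hΔ φ hφ hinit p hp).le

theorem lemma1 {n : ℕ} (H : HybridSystem n) (hH : H.BasicConditions)
    (Me Mi Mo : Set (EuclideanSpace ℝ (Fin n)))
    (hMe : IsClosed Me) (hMe_inv : H.StronglyForwardInvariant Me)
    (hMi : IsClosed Mi) (hMi_sub : Mi ⊆ Me) (hMi_stable : H.StableRel Mi Me)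
    (hMo : IsCompact Mo) (hMo_ne : Mo.Nonempty) (hMo_sub : Mo ⊆ Mi)
    (hMo_stable : H.StableRel Mo Mi) :
    (H.GloballyAttractiveRel Mi Me → H.GloballyAttractiveRel Mo Mi →
      H.UASRel Mo Me ∧
      IsGreatest {S : Set (EuclideanSpace ℝ (Fin n)) |
        S ⊆ Me ∧ ∀ φ, H.IsSolution φ → φ.init ∈ S → φ.IsBounded} (H.basin Mo ∩ Me) ∧
      (H.UGBRel Me → H.UGASRel Mo Me)) ∧
    (H.AttractiveRel Mi Me → H.AttractiveRel Mo Mi → H.UASRel Mo Me) :=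
  lemma1_general H hH Me Mi Mo hMe_inv hMi hMi_stable hMo.isBounded hMo_ne hMo_sub hMo_stable
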